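/- Let $R=P/Q$ be a non-constant rational function on the Riemann sphere $\hat{\mathbb C}$ ($P,Q$ relatively prime polynomials), of degree $\deg R=\max\{\deg P,\deg Q\}\ge 1$, and let $e(x)$ be the branch index of $R$ at $x$, i.e. the order of vanishing at $x$ of $R-R(x)$ in local charts. The Fatou set is the largest open subset of $\hat{\mathbb C}$ on which the iterates $(R^n)_n$ are equicontinuous; the Julia set $J_R$ is its complement. Assume $J_R\neq\emptyset$ (automatic if $\deg R\ge 2$). Recall that $R(J_R)=J_R=R^{-1}(J_R)$. Let $A=C(J_R)$ and $X=C(\operatorname{graph}R|_{J_R})$, where $\operatorname{graph}R|_{J_R}=\{(x,y)\in J_R\times J_R: y=R(x)\}$. Then $X$ is a Hilbert bimodule over $A$ via $$(\phi(a)f\,b)(x,y)=a(x)f(x,y)b(y),\qquad (f|g)_A(y)=\sum_{x\in R^{-1}(y)}e(x)\,\overline{f(x,y)}\,g(x,y).$$ Let $\mathcal O_R$ be its Cuntz--Pimsner algebra, that is, the universal $C^*$-algebra generated by $i(a)$ ($a\in A$) and $S_\xi$ ($\xi\in X$), where $i$ is a unital $*$-homomorphism and $S$ is linear, subject to $i(a)S_\xi=S_{\phi(a)\xi}$,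 $S_\xi i(a)=S_{\xi a}$, $S_\xi^*S_\eta=i((\xi|\eta)_A)$, and $i(a)=i_K(\phi(a))$ for all $a\in A$ with $\phi(a)\in K(X)$. Here $K(X)$ is the closed linear span of the operators $\theta_{\xi,\eta}(\zeta)=\xi(\eta|\zeta)_A$, and $i_K$ is the continuous linear map on $K(X)$ with $i_K(\theta_{\xi,\eta})=S_\xi S_\eta^*$. Let $\alpha:A\to A$ be the endomorphism $\alpha(a)=a\circ R$, and let $$E_R(a)(y)=\frac1{\deg R}\sum_{x\in R^{-1}(y)}e(x)\,a(x)\qquad(a\in A,\ y\in J_R),$$ which is a transfer operator for $\alpha$: it is a continuous positive linear map $A\to A$ with $E_R(\alpha(a)b)=a\,E_R(b)$. Exel's crossed product $A\rtimes_{\alpha,E_R}\mathbb N$ is defined as follows. Let $\mathcal T(A,\alpha,E_R)$ be the universal unital $C^*$-algebra generated by (the image of) $A$, under a unital $*$-homomorphism, and one element $S$, subject to $Sa=\alpha(a)S$ and $S^*aS=E_R(a)$ for $a\in A$. A redundancy is a pair $(a,k)$ with $a\in A$, $k\in\overline{\operatorname{span}}\,(ASS^*A)$ and $abS=kbS$ for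 all $b\in A$. Then $A\rtimes_{\alpha,E_R}\mathbb N$ is the quotient of $\mathcal T(A,\alpha,E_R)$ by the closed two-sided ideal generated by the differences $a-k$, for all redundancies $(a,k)$ with $a\in\overline{\operatorname{span}}\,(A\alpha(A)A)$. Then $\mathcal O_R$ is $*$-isomorphic to $C(J_R)\rtimes_{\alpha,E_R}\mathbb N$. -/

import Mathlib

open Polynomial Topology Filter

namespace JuliaAlgebra

noncomputable section

section CStar

universe u

open scoped ENNReal

/-! ### Universal C⋆-algebras -/

instance lpCStarAlgebra {I : Type*} {B : I → Type*} [∀ i, CStarAlgebra (B i)]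
    [∀ i, Nontrivial (B i)] : CStarAlgebra (lp B ∞) where

/-- Relations on a family of generators indexed by `G`: `Holds B g` says that the elements `g x` of
the unital C⋆-algebra `B` satisfy them. They are required to bound the norms of the generators, so
that a universal C⋆-algebra exists. -/
structure Relations (G : Type u) where
  Holds : ∀ (B : Type u) [CStarAlgebra B], (G → B) → Prop
  bound : G → ℝ
  norm_le : ∀ (B : Type u) [CStarAlgebra B] (g : G → B), Holds B g → ∀ x, ‖g x‖ ≤ bound x

/-- A representation of the relations in a nonzero unital C⋆-algebra. -/
structure Relations.Rep {G : Type u} (P : Relations G) : Type (u + 1) where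
  B : Type u
  [alg : CStarAlgebra B]
  [nontriv : Nontrivial B]
  gen : G → B
  holds : P.Holds B gen

attribute [instance] Relations.Rep.alg Relations.Rep.nontriv

/-- The value in `B` of a noncommutative polynomial in the generators and their adjoints. -/
def evalStar {G : Type u} {B : Type u} [CStarAlgebra B] (g : G → B) :
    FreeAlgebra ℂ (G ⊕ G) →ₐ[ℂ] B :=
  FreeAlgebra.lift ℂ (Sum.elim g fun x => star (g x))

/-- The C⋆-seminorm that a representation induces on noncommutative ⋆-polynomials. -/
def Relations.Rep.seminorm {G : Type u} {P : Relations G} (ρ : P.Rep) :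
    FreeAlgebra ℂ (G ⊕ G) → ℝ :=
  fun p => ‖evalStar ρ.gen p‖

/-- The C⋆-seminorms coming from representations. Two representations with the same seminorm
generate isomorphic C⋆-algebras, so these index all representations up to equivalence. -/
abbrev Relations.Index {G : Type u} (P : Relations G) : Type u :=
  Set.range (Relations.Rep.seminorm (P := P))

/-- A representation with the given seminorm. -/
def Relations.rep {G : Type u} (P : Relations G) (N : P.Index) : P.Rep := N.2.choose

theorem Relations.rep_seminorm {G : Type u} (P : Relations G) (N : P.Index) :
    (P.rep N).seminorm = N.1 := N.2.choose_spec

/-- The generators in the `ℓ^∞`-product of all representations. -/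
def Relations.prodGen {G : Type u} (P : Relations G) (x : G) :
    lp (fun N : P.Index => (P.rep N).B) ∞ :=
  ⟨fun N => (P.rep N).gen x, memℓp_infty ⟨P.bound x, by
    rintro _ ⟨N, rfl⟩
    exact P.norm_le _ _ (P.rep N).holds x⟩⟩

/-- The universal unital C⋆-algebra with the given generators and relations: the C⋆-algebra
generated by the generators in the product of all representations. -/
def Relations.universal {G : Type u} (P : Relations G) :
    StarSubalgebra ℂ (lp (fun N : P.Index => (P.rep N).B) ∞) :=
  (StarAlgebra.adjoin ℂ (Set.range P.prodGen)).topologicalClosure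

/-- The universal unital C⋆-algebra as a type. -/
abbrev Relations.Universal {G : Type u} (P : Relations G) : Type u := P.universal

instance Relations.instCStarAlgebra {G : Type u} (P : Relations G) : CStarAlgebra P.Universal :=
  StarSubalgebra.cstarAlgebra P.universal
    (h_closed := StarSubalgebra.isClosed_topologicalClosure _)

/-- The canonical generators of the universal C⋆-algebra. -/
def Relations.gen {G : Type u} (P : Relations G) (x : G) : P.Universal :=
  ⟨P.prodGen x, StarSubalgebra.le_topologicalClosure _
    (StarAlgebra.subset_adjoin ℂ _ ⟨x, rfl⟩)⟩

theorem exists_evalStar_star {G : Type u} (p : FreeAlgebra ℂ (G ⊕ G)) :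
    ∃ q : FreeAlgebra ℂ (G ⊕ G), ∀ (B : Type u) [CStarAlgebra B] (g : G → B),
      star (evalStar g p) = evalStar g q := by
  induction p using FreeAlgebra.induction with
  | grade0 r =>
    refine ⟨algebraMap ℂ _ (star r), fun B _ g => ?_⟩
    rw [AlgHom.commutes, AlgHom.commutes, algebraMap_star_comm]
  | grade1 x =>
    rcases x with x | x
    · exact ⟨FreeAlgebra.ι ℂ (Sum.inr x), fun B _ g => by simp [evalStar]⟩
    · exact ⟨FreeAlgebra.ι ℂ (Sum.inl x), fun B _ g => by simp [evalStar]⟩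
  | mul a b ha hb =>
    obtain ⟨a', ha⟩ := ha
    obtain ⟨b', hb⟩ := hb
    exact ⟨b' * a', fun B _ g => by rw [map_mul, map_mul, star_mul, ha, hb]⟩
  | add a b ha hb =>
    obtain ⟨a', ha⟩ := ha
    obtain ⟨b', hb⟩ := hb
    exact ⟨a' + b', fun B _ g => by rw [map_add, map_add, star_add, ha, hb]⟩

theorem map_evalStar {G : Type u} {B C : Type u} [CStarAlgebra B] [CStarAlgebra C]
    (ψ : B →⋆ₐ[ℂ] C) (g : G → B) (p : FreeAlgebra ℂ (G ⊕ G)) :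
    ψ (evalStar g p) = evalStar (fun x => ψ (g x)) p := by
  have : (ψ : B →ₐ[ℂ] C).comp (evalStar g) = evalStar fun x => ψ (g x) := by
    refine FreeAlgebra.hom_ext (funext fun x => ?_)
    rcases x with x | x
    · simp [evalStar]
    · simp [evalStar, map_star]
  exact DFunLike.congr_fun this p

theorem evalStar_mem {G : Type u} {B : Type u} [CStarAlgebra B] {g : G → B}
    (Γ : StarSubalgebra ℂ B) (h : ∀ x, g x ∈ Γ) (p : FreeAlgebra ℂ (G ⊕ G)) :
    evalStar g p ∈ Γ := by
  induction p using FreeAlgebra.induction with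
  | grade0 r => rw [AlgHom.commutes]; exact Γ.algebraMap_mem r
  | grade1 x =>
    rcases x with x | x
    · simpa [evalStar] using h x
    · simpa [evalStar] using star_mem (h x)
  | mul a b ha hb => rw [map_mul]; exact mul_mem ha hb
  | add a b ha hb => rw [map_add]; exact add_mem ha hb

theorem exists_evalStar_of_mem_adjoin {G : Type u} {B : Type u} [CStarAlgebra B] {g : G → B}
    {b : B} (hb : b ∈ StarAlgebra.adjoin ℂ (Set.range g)) : ∃ p, evalStar g p = b := by
  induction hb using StarAlgebra.adjoin_induction with
  | mem x hx =>
    obtain ⟨x, rfl⟩ := hx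
    exact ⟨FreeAlgebra.ι ℂ (Sum.inl x), by simp [evalStar]⟩
  | algebraMap r => exact ⟨algebraMap ℂ _ r, by simp⟩
  | add x y _ _ hx hy =>
    obtain ⟨p, rfl⟩ := hx
    obtain ⟨q, rfl⟩ := hy
    exact ⟨p + q, map_add _ _ _⟩
  | mul x y _ _ hx hy =>
    obtain ⟨p, rfl⟩ := hx
    obtain ⟨q, rfl⟩ := hy
    exact ⟨p * q, map_mul _ _ _⟩
  | star x _ hx =>
    obtain ⟨p, rfl⟩ := hx
    obtain ⟨q, hq⟩ := exists_evalStar_star p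
    exact ⟨q, (hq B g).symm⟩

theorem Relations.norm_evalStar_le {G : Type u} (P : Relations G) {B : Type u} [CStarAlgebra B]
    {g : G → B} (h : P.Holds B g) (p : FreeAlgebra ℂ (G ⊕ G)) :
    ‖evalStar g p‖ ≤ ‖evalStar P.prodGen p‖ := by
  rcases subsingleton_or_nontrivial B with hB | hB
  · rw [Subsingleton.elim (evalStar g p) 0, norm_zero]
    exact norm_nonneg _
  · let ρ : P.Rep := { B := B, gen := g, holds := h }
    let N : P.Index := ⟨ρ.seminorm, ρ, rfl⟩
    have h1 : ‖evalStar g p‖ = ‖evalStar (P.rep N).gen p‖ :=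
      (congrFun (P.rep_seminorm N) p).symm
    have h2 : (evalStar P.prodGen p : lp (fun N : P.Index => (P.rep N).B) ∞) N =
        evalStar (P.rep N).gen p := by
      let ev : lp (fun N : P.Index => (P.rep N).B) ∞ →⋆ₐ[ℂ] (P.rep N).B :=
        { toFun := fun b => b N
          map_one' := rfl
          map_mul' := fun _ _ => rfl
          map_zero' := rfl
          map_add' := fun _ _ => rfl
          commutes' := fun _ => rfl
          map_star' := fun _ => rfl }
      exact map_evalStar ev P.prodGen p
    rw [h1, ← h2]
    exact lp.norm_apply_le_norm ENNReal.top_ne_zero _ N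

/-- The universal property of the universal C⋆-algebra. -/
theorem Relations.existsUnique_lift {G : Type u} (P : Relations G) {B : Type u} [CStarAlgebra B]
    {g : G → B} (h : P.Holds B g) :
    ∃! ψ : P.Universal →⋆ₐ[ℂ] B, ∀ x, ψ (P.gen x) = g x := by
  let M := lp (fun N : P.Index => (P.rep N).B) ∞
  let γ : G → M × B := fun x => (P.prodGen x, g x)
  let Γ : StarSubalgebra ℂ (M × B) := (StarAlgebra.adjoin ℂ (Set.range γ)).topologicalClosure
  have hΓc : IsClosed (Γ : Set (M × B)) := StarSubalgebra.isClosed_topologicalClosure _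
  let fst : M × B →⋆ₐ[ℂ] M := StarAlgHom.fst ℂ M B
  let snd : M × B →⋆ₐ[ℂ] B := StarAlgHom.snd ℂ M B
  have hle : ∀ z ∈ Γ, ‖z.2‖ ≤ ‖z.1‖ := by
    have hcl : IsClosed {z : M × B | ‖z.2‖ ≤ ‖z.1‖} :=
      isClosed_le (continuous_snd.norm) (continuous_fst.norm)
    refine closure_minimal ?_ hcl
    intro z hz
    obtain ⟨p, rfl⟩ := exists_evalStar_of_mem_adjoin hz
    have h1 : (evalStar γ p).1 = evalStar P.prodGen p := map_evalStar fst γ p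
    have h2 : (evalStar γ p).2 = evalStar g p := map_evalStar snd γ p
    change ‖(evalStar γ p).2‖ ≤ ‖(evalStar γ p).1‖
    rw [h1, h2]
    exact P.norm_evalStar_le h p
  have hmem : ∀ z ∈ Γ, z.1 ∈ P.universal := by
    have hcl : IsClosed {z : M × B | z.1 ∈ P.universal} :=
      (StarSubalgebra.isClosed_topologicalClosure _).preimage continuous_fst
    refine closure_minimal ?_ hcl
    intro z hz
    have : fst z ∈ (StarAlgebra.adjoin ℂ (Set.range γ)).map fst := ⟨z, hz, rfl⟩
    rw [StarAlgHom.map_adjoin, ← Set.range_comp] at this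
    exact StarSubalgebra.le_topologicalClosure _ this
  let π : Γ →⋆ₐ[ℂ] P.Universal := (fst.comp Γ.subtype).codRestrict P.universal
    fun z => hmem z.1 z.2
  have hiso : Isometry π := by
    refine AddMonoidHomClass.isometry_of_norm π fun z => ?_
    change ‖z.1.1‖ = max ‖z.1.1‖ ‖z.1.2‖
    rw [max_eq_left (hle z.1 z.2)]
  have : CompleteSpace Γ := hΓc.completeSpace_coe
  have hsurj : Function.Surjective π := by
    have hcr : IsClosed (Set.range π) := hiso.isClosedEmbedding.isClosed_range
    have hcr' : IsClosed (Subtype.val '' Set.range π : Set M) :=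
      (StarSubalgebra.isClosed_topologicalClosure _).isClosedEmbedding_subtypeVal.isClosedMap _ hcr
    have hsub : (P.universal : Set M) ⊆ Subtype.val '' Set.range π := by
      refine closure_minimal ?_ hcr'
      intro b hb
      obtain ⟨p, rfl⟩ := exists_evalStar_of_mem_adjoin hb
      have hp : evalStar γ p ∈ Γ := by
        refine evalStar_mem Γ (fun x => ?_) p
        exact StarSubalgebra.le_topologicalClosure _ (StarAlgebra.subset_adjoin ℂ _ ⟨x, rfl⟩)
      exact ⟨π ⟨_, hp⟩, ⟨_, rfl⟩, map_evalStar fst γ p⟩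
    intro b
    obtain ⟨_, ⟨z, rfl⟩, hz⟩ := hsub b.2
    exact ⟨z, Subtype.ext hz⟩
  let e : Γ ≃⋆ₐ[ℂ] P.Universal := StarAlgEquiv.ofBijective π ⟨hiso.injective, hsurj⟩
  have hγ : ∀ x, γ x ∈ Γ := fun x =>
    StarSubalgebra.le_topologicalClosure _ (StarAlgebra.subset_adjoin ℂ _ ⟨x, rfl⟩)
  let φ : P.Universal →⋆ₐ[ℂ] B := (snd.comp Γ.subtype).comp (e.symm : P.Universal →⋆ₐ[ℂ] Γ)
  have hexists : ∀ x, φ (P.gen x) = g x := by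
    intro x
    have h1 : e.symm (P.gen x) = ⟨γ x, hγ x⟩ := by
      have h2 : P.gen x = e ⟨γ x, hγ x⟩ := rfl
      rw [h2]
      exact StarAlgEquiv.symm_apply_apply e _
    change snd (e.symm (P.gen x)).1 = g x
    rw [h1]
    rfl
  refine ⟨φ, hexists, ?_⟩
  · intro ψ hψ
    have hc : ∀ χ : P.Universal →⋆ₐ[ℂ] B, Continuous χ := fun χ =>
      AddMonoidHomClass.continuous_of_bound χ 1 fun u => by
        rw [one_mul]; exact NonUnitalStarAlgHom.norm_apply_le χ u
    refine StarAlgHom.ext_topologicalClosure (hc ψ) (hc φ) ?_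
    refine StarAlgHom.ext_adjoin ?_
    rintro ⟨_, hx⟩ ⟨x, rfl⟩
    exact (hψ x).trans (hexists x).symm

/-! ### Cuntz–Pimsner algebras of Hilbert bimodules

The coefficient algebra `A` is commutative here, so that there is no difference between left and
right `A`-modules, and Mathlib's Hilbert C⋆-modules can be used. Below, `a • ξ` is the right
multiplication `ξ a`; the left multiplication is a separate datum `φ`. -/

section CuntzPimsner

variable (A X : Type u) [CommCStarAlgebra A] [PartialOrder A] [StarOrderedRing A]
  [NormedAddCommGroup X] [NormedSpace ℂ X] [SMul A X] [CStarModule A X]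

/-- A left action making the Hilbert `A`-module `X` a Hilbert bimodule: a unital ⋆-homomorphism `φ`
from `A` to the adjointable operators on `X`. -/
structure LeftAction [CompleteSpace X] where
  φ : A →ₐ[ℂ] (X →L[ℂ] X)
  inner_φ : ∀ (a : A) (ξ η : X), inner A (φ a ξ) η = inner A ξ (φ (star a) η)

variable {X}

set_option linter.unusedSectionVars false in
theorem ext_inner {x y : X} (h : ∀ z : X, inner A z x = inner A z y) : x = y := by
  rw [← sub_eq_zero, ← CStarModule.inner_self (A := A), CStarModule.inner_sub_right, h, sub_self]

set_option linter.unusedSectionVars false in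
theorem norm_smul_le_mul (a : A) (x : X) : ‖a • x‖ ≤ ‖a‖ * ‖x‖ := by
  have h : ‖a • x‖ ^ 2 ≤ (‖a‖ * ‖x‖) ^ 2 := by
    rw [CStarModule.norm_sq_eq A, CStarModule.inner_op_smul_right, CStarModule.inner_op_smul_left,
      mul_pow, CStarModule.norm_sq_eq A (x := x)]
    calc ‖a * (inner A x x * star a)‖ ≤ ‖a‖ * (‖inner A x x‖ * ‖star a‖) :=
          (norm_mul_le _ _).trans (mul_le_mul_of_nonneg_left (norm_mul_le _ _) (norm_nonneg _))
      _ = ‖a‖ ^ 2 * ‖inner A x x‖ := by rw [norm_star]; ring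
  exact (pow_le_pow_iff_left₀ (norm_nonneg _) (by positivity) two_ne_zero).1 h

/-- The rank one operator `θ_{ξ, η} : ζ ↦ ξ (η | ζ)`. -/
def rankOne (ξ η : X) : X →L[ℂ] X :=
  LinearMap.mkContinuous
    { toFun := fun ζ => inner A η ζ • ξ
      map_add' := fun x y => ext_inner A fun z => by
        simp only [CStarModule.inner_op_smul_right, CStarModule.inner_add_right, add_mul]
      map_smul' := fun c x => ext_inner A fun z => by
        simp only [CStarModule.inner_op_smul_right, CStarModule.inner_smul_right_complex,
          smul_mul_assoc, RingHom.id_apply] }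
    (‖η‖ * ‖ξ‖) fun ζ => by
      calc ‖inner A η ζ • ξ‖ ≤ ‖inner A η ζ‖ * ‖ξ‖ := norm_smul_le_mul A _ _
        _ ≤ (‖η‖ * ‖ζ‖) * ‖ξ‖ :=
          mul_le_mul_of_nonneg_right (CStarModule.norm_inner_le X) (norm_nonneg _)
        _ = ‖η‖ * ‖ξ‖ * ‖ζ‖ := by ring

variable (X)

/-- The compact operators `K(X)`: the closed linear span of the rank one operators. -/
def compactOperators : Submodule ℂ (X →L[ℂ] X) :=
  (Submodule.span ℂ (Set.range fun p : X × X => rankOne A p.1 p.2)).topologicalClosure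

variable {X}

theorem rankOne_mem (ξ η : X) : rankOne A ξ η ∈ compactOperators A X :=
  Submodule.le_topologicalClosure _ (Submodule.subset_span ⟨(ξ, η), rfl⟩)

variable {A} [CompleteSpace X]

/-- The relations between `i(a)` and `S_ξ` which define the Cuntz–Pimsner algebra. In the last one,
`iK : K(X) → B` is the map with `iK(θ_{ξ, η}) = S_ξ S_η^*`, which is determined by linearity and
continuity, and `i(a) = iK(φ(a))` is required for `a` in `I_X = φ⁻¹(K(X))`. -/
structure IsCovariant (Φ : LeftAction A X) {B : Type u} [CStarAlgebra B] (i : A →⋆ₐ[ℂ] B)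
    (S : X →ₗ[ℂ] B) : Prop where
  left : ∀ a ξ, i a * S ξ = S (Φ.φ a ξ)
  right : ∀ a ξ, S ξ * i a = S (a • ξ)
  star_mul : ∀ ξ η, star (S ξ) * S η = i (inner A ξ η)
  covariant : ∃ iK : compactOperators A X →L[ℂ] B,
    (∀ ξ η, iK ⟨rankOne A ξ η, rankOne_mem A ξ η⟩ = S ξ * star (S η)) ∧
    ∀ (a : A) (ha : Φ.φ a ∈ compactOperators A X), i a = iK ⟨Φ.φ a, ha⟩

theorem IsCovariant.norm_le {Φ : LeftAction A X} {B : Type u} [CStarAlgebra B] {i : A →⋆ₐ[ℂ] B}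
    {S : X →ₗ[ℂ] B} (h : IsCovariant Φ i S) (ξ : X) : ‖S ξ‖ ≤ ‖ξ‖ := by
  have : ‖S ξ‖ ^ 2 ≤ ‖ξ‖ ^ 2 := by
    rw [sq, ← CStarRing.norm_star_mul_self, h.star_mul, CStarModule.norm_sq_eq A]
    exact NonUnitalStarAlgHom.norm_apply_le i _
  exact (pow_le_pow_iff_left₀ (norm_nonneg _) (norm_nonneg _) two_ne_zero).1 this

/-- The generators `i(a)`, `S_ξ` and the relations of the Cuntz–Pimsner algebra. -/
def cuntzPimsnerRelations (Φ : LeftAction A X) : Relations (A ⊕ X) where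
  Holds B _ g := ∃ (i : A →⋆ₐ[ℂ] B) (S : X →ₗ[ℂ] B), IsCovariant Φ i S ∧ g = Sum.elim i S
  bound := Sum.elim norm norm
  norm_le := by
    rintro B _ _ ⟨i, S, h, rfl⟩ (a | ξ)
    · exact NonUnitalStarAlgHom.norm_apply_le i a
    · exact h.norm_le ξ

/-- The Cuntz–Pimsner algebra `O_X`. -/
abbrev CuntzPimsner (Φ : LeftAction A X) : Type u := (cuntzPimsnerRelations Φ).Universal

end CuntzPimsner

/-! ### Exel's crossed product by an endomorphism with a transfer operator -/

section Exel

/-- An endomorphism `α` of a unital C⋆-algebra with a transfer operator `L`, that is, a continuous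
positive linear map with `L (α(a) b) = a L(b)`. -/
structure TransferSystem (A : Type u) [CStarAlgebra A] where
  α : A →⋆ₙₐ[ℂ] A
  L : A →L[ℂ] A
  L_pos : ∀ a, ∃ b, L (star a * a) = star b * b
  L_α_mul : ∀ a b, L (α a * b) = a * L b

variable {A : Type u} [CStarAlgebra A]

/-- The generators and relations of the Toeplitz algebra `T(A, α, L)`: the algebra `A` and one more
element `S` with `S a = α(a) S` and `S^* a S = L(a)`. -/
def toeplitzRelations (D : TransferSystem A) : Relations (A ⊕ PUnit.{u + 1}) where
  Holds B _ g := ∃ (i : A →⋆ₐ[ℂ] B) (S : B), (∀ a, S * i a = i (D.α a) * S) ∧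
    (∀ a, star S * i a * S = i (D.L a)) ∧ g = Sum.elim i fun _ => S
  bound := Sum.elim norm fun _ => √‖D.L 1‖
  norm_le := by
    rintro B _ _ ⟨i, S, -, h, rfl⟩ (a | _)
    · exact NonUnitalStarAlgHom.norm_apply_le i a
    · refine Real.le_sqrt_of_sq_le ?_
      have h1 := h 1
      rw [map_one, mul_one] at h1
      simp only [Sum.elim_inr]
      rw [sq, ← CStarRing.norm_star_mul_self, h1]
      exact NonUnitalStarAlgHom.norm_apply_le i _

/-- The Toeplitz algebra `T(A, α, L)`. -/
abbrev ExelToeplitz (D : TransferSystem A) : Type u := (toeplitzRelations D).Universal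

/-- The canonical copy of `a : A` in the Toeplitz algebra. -/
def ExelToeplitz.ofA (D : TransferSystem A) (a : A) : ExelToeplitz D :=
  (toeplitzRelations D).gen (Sum.inl a)

/-- The canonical element `S` of the Toeplitz algebra. -/
def ExelToeplitz.S (D : TransferSystem A) : ExelToeplitz D :=
  (toeplitzRelations D).gen (Sum.inr PUnit.unit)

open ExelToeplitz in
/-- A redundancy: a pair `(a, k)` with `k` in the closed linear span of `A S S^* A` and
`a b S = k b S` for all `b` in `A`. -/
def IsRedundancy (D : TransferSystem A) (a : A) (k : ExelToeplitz D) : Prop :=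
  k ∈ closure (Submodule.span ℂ (Set.range fun p : A × A =>
    ofA D p.1 * S D * star (S D) * ofA D p.2) : Set (ExelToeplitz D)) ∧
  ∀ b, ofA D a * ofA D b * S D = k * ofA D b * S D

/-- The closed two-sided ideal of the Toeplitz algebra generated by the differences `a - k`, for all
redundancies `(a, k)` with `a` in the closed two-sided ideal of `A` generated by `α(A)`. (Closed
two-sided ideals of C⋆-algebras are self-adjoint.) -/
def redundancyIdeal (D : TransferSystem A) : TwoSidedIdeal (ExelToeplitz D) :=
  sInf {I | IsClosed (I : Set (ExelToeplitz D)) ∧ (∀ x ∈ I, star x ∈ I) ∧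
    ∀ a k, IsRedundancy D a k →
      a ∈ closure (Submodule.span ℂ (Set.range fun p : A × A × A =>
        p.1 * D.α p.2.1 * p.2.2) : Set A) →
      ExelToeplitz.ofA D a - k ∈ I}

theorem star_mem_redundancyIdeal (D : TransferSystem A) {x : ExelToeplitz D}
    (hx : x ∈ redundancyIdeal D) : star x ∈ redundancyIdeal D := by
  rw [redundancyIdeal, TwoSidedIdeal.mem_sInf] at hx ⊢
  exact fun I hI => hI.2.1 x (hx I hI)

/-- Exel's crossed product `A ⋊_{α, L} ℕ`, the quotient of the Toeplitz algebra by the ideal of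
redundancies. -/
abbrev ExelCrossedProduct (D : TransferSystem A) : Type u := (redundancyIdeal D).ringCon.Quotient

instance (D : TransferSystem A) : StarRing (ExelCrossedProduct D) where
  star := Quotient.map' star fun x y h => by
    have h' : x - y ∈ redundancyIdeal D := (TwoSidedIdeal.rel_iff _ _ _).1 h
    refine (TwoSidedIdeal.rel_iff _ _ _).2 ?_
    rw [← star_sub]
    exact star_mem_redundancyIdeal D h'
  star_involutive := by
    rintro ⟨x⟩
    exact congrArg _ (star_star x)
  star_mul := by
    rintro ⟨x⟩ ⟨y⟩
    exact congrArg _ (star_mul x y)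
  star_add := by
    rintro ⟨x⟩ ⟨y⟩
    exact congrArg _ (star_add x y)

instance (D : TransferSystem A) : StarModule ℂ (ExelCrossedProduct D) where
  star_smul := by
    rintro c ⟨x⟩
    exact congrArg _ (star_smul c x)

end Exel

end CStar

open scoped OnePoint

/-! ### Rational functions as self-maps of the Riemann sphere -/

/-- The Riemann sphere `ℂ ∪ {∞}`, a compact Hausdorff space. -/
abbrev Sphere : Type := OnePoint ℂ

/-- The point of the sphere with homogeneous coordinates `[p : q]` (for `(p, q) ≠ (0, 0)`). -/
def ratio (p q : ℂ) : Sphere := if q = 0 then ∞ else ((p / q : ℂ) : Sphere)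

/-- The degree `max (deg P) (deg Q)` of `R = P / Q` in lowest terms. -/
def degree (R : RatFunc ℂ) : ℕ := max R.num.natDegree R.denom.natDegree

/-- The self-map of the Riemann sphere given by `R = P / Q`; its value at `∞` is the limit of
`P z / Q z`, read off from the coefficients of `P` and `Q` in degree `degree R`. -/
def toMap (R : RatFunc ℂ) (z : Sphere) : Sphere :=
  z.elim (ratio (R.num.coeff (degree R)) (R.denom.coeff (degree R)))
    (fun x => ratio (R.num.eval x) (R.denom.eval x))

/-- The branch index `e_R(z)`. At a finite point `x` it is the multiplicity of the zero at `x` of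
`Q(x) P - P(x) Q`, that is, of the zero of `R - R(x)` if `R(x)` is finite, and of `1 / R` if
`R(x) = ∞`. At `∞` the same is done at `0` in the coordinate `1 / z`. -/
def branchIndex (R : RatFunc ℂ) (z : Sphere) : ℕ :=
  z.elim
    ((C (R.denom.coeff (degree R)) * R.num.reflect (degree R) -
      C (R.num.coeff (degree R)) * R.denom.reflect (degree R)).rootMultiplicity 0)
    (fun x => (C (R.denom.eval x) * R.num - C (R.num.eval x) * R.denom).rootMultiplicity x)

theorem ratio_smul {c : ℂ} (hc : c ≠ 0) (p q : ℂ) : ratio (c * p) (c * q) = ratio p q := by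
  unfold ratio
  by_cases hq : q = 0
  · simp [hq]
  · simp [hq, hc, mul_div_mul_left]

theorem ratio_eq_iff {a b p q : ℂ} (h : (a, b) ≠ (0, 0)) (h' : (p, q) ≠ (0, 0)) :
    ratio a b = ratio p q ↔ a * q = p * b := by
  unfold ratio
  by_cases hb : b = 0 <;> by_cases hq : q = 0
  · simp [hb, hq]
  · have : a ≠ 0 := by rintro rfl; simp [hb] at h
    simp [hb, hq, this]
  · have : p ≠ 0 := by rintro rfl; simp [hq] at h'
    simp [hb, hq, this]
  · simp [hb, hq, div_eq_div_iff]

theorem exists_smul_of_ratio_eq {a b p q : ℂ} (h : (a, b) ≠ (0, 0)) (h' : (p, q) ≠ (0, 0))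
    (e : ratio a b = ratio p q) : ∃ t : ℂ, t ≠ 0 ∧ a = t * p ∧ b = t * q := by
  rw [ratio_eq_iff h h'] at e
  by_cases hq : q = 0
  · have hp : p ≠ 0 := by rintro rfl; simp [hq] at h'
    have hb : b = 0 := by simpa [hq, hp] using e
    have ha : a ≠ 0 := by rintro rfl; simp [hb] at h
    exact ⟨a / p, div_ne_zero ha hp, by field_simp, by simp [hb, hq]⟩
  · have hb : b ≠ 0 := by
      rintro rfl
      have : a = 0 := by simpa [hq] using e
      simp [this] at h
    exact ⟨b / q, div_ne_zero hb hq, by field_simp; linear_combination e, by field_simp⟩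

theorem continuousAt_ratio {v : ℂ × ℂ} (hv : v ≠ (0, 0)) :
    ContinuousAt (fun w : ℂ × ℂ => ratio w.1 w.2) v := by
  obtain ⟨a, b⟩ := v
  by_cases hb : b = 0
  · subst hb
    have ha : a ≠ 0 := by rintro rfl; simp at hv
    have hval : ratio a 0 = ∞ := by simp [ratio]
    rw [ContinuousAt]
    simp only [hval]
    rw [OnePoint.hasBasis_nhds_infty.tendsto_right_iff]
    rintro s ⟨-, hs⟩
    obtain ⟨M, hM⟩ := hs.isBounded.exists_norm_le
    have h1 : ∀ᶠ w : ℂ × ℂ in 𝓝 (a, 0), ‖w.2‖ * M < ‖w.1‖ := by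
      have c1 : ContinuousAt (fun w : ℂ × ℂ => ‖w.2‖ * M) (a, 0) := by fun_prop
      have c2 : ContinuousAt (fun w : ℂ × ℂ => ‖w.1‖) (a, 0) := by fun_prop
      exact c1.tendsto.eventually_lt c2.tendsto (by simpa using ha)
    filter_upwards [h1] with w hw
    by_cases h2 : w.2 = 0
    · right; simp [ratio, h2]
    · left
      refine ⟨w.1 / w.2, fun hmem => ?_, by simp [ratio, h2]⟩
      have := hM _ hmem
      rw [norm_div, div_le_iff₀ (norm_pos_iff.2 h2)] at this
      linarith [mul_comm M ‖w.2‖]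
  · have : (fun w : ℂ × ℂ => ratio w.1 w.2) =ᶠ[𝓝 (a, b)]
        fun w => ((w.1 / w.2 : ℂ) : Sphere) := by
      have : ∀ᶠ w : ℂ × ℂ in 𝓝 (a, b), w.2 ≠ 0 :=
        (continuous_snd.continuousAt (x := (a, b))).eventually_ne hb
      filter_upwards [this] with w hw
      simp [ratio, hw]
    refine ContinuousAt.congr ?_ this.symm
    refine OnePoint.continuous_coe.continuousAt.comp ?_
    exact continuousAt_fst.div continuousAt_snd hb

/-- The unit sphere of `ℂ²`, used to parametrize the Riemann sphere. -/
abbrev Unit2 : Type := Metric.sphere (0 : ℂ × ℂ) 1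

theorem Unit2.ne (v : Unit2) : v.1 ≠ (0, 0) := by
  intro h
  have := v.2
  rw [h] at this
  simp at this

/-- The point of the Riemann sphere with homogeneous coordinates `v`. -/
def pt (v : Unit2) : Sphere := ratio v.1.1 v.1.2

theorem continuous_pt : Continuous pt := by
  rw [continuous_iff_continuousAt]
  intro v
  exact ContinuousAt.comp (g := fun w : ℂ × ℂ => ratio w.1 w.2) (continuousAt_ratio v.ne)
    continuousAt_subtype_val

theorem exists_unit2 {a b : ℂ} (h : (a, b) ≠ (0, 0)) :
    ∃ (v : Unit2) (t : ℂ), t ≠ 0 ∧ v.1.1 = t * a ∧ v.1.2 = t * b := by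
  have hn : ‖((a, b) : ℂ × ℂ)‖ ≠ 0 := norm_ne_zero_iff.2 h
  refine ⟨⟨((‖((a, b) : ℂ × ℂ)‖⁻¹ : ℝ) : ℂ) • (a, b), ?_⟩, ((‖((a, b) : ℂ × ℂ)‖⁻¹ : ℝ) : ℂ),
    ?_, rfl, rfl⟩
  · rw [mem_sphere_zero_iff_norm, norm_smul, Complex.norm_real, norm_inv, norm_norm,
      inv_mul_cancel₀ hn]
  · exact_mod_cast inv_ne_zero hn

theorem pt_surjective : Function.Surjective pt := by
  intro z
  have key : ∀ {a b : ℂ}, (a, b) ≠ (0, 0) → ∃ v, pt v = ratio a b := by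
    intro a b h
    obtain ⟨v, t, ht, h1, h2⟩ := exists_unit2 h
    exact ⟨v, by rw [pt, h1, h2, ratio_smul ht]⟩
  induction z using OnePoint.rec with
  | infty => simpa [ratio] using key (a := 1) (b := 0) (by simp)
  | coe z => simpa [ratio] using key (a := z) (b := 1) (by simp)

theorem isQuotientMap_pt : IsQuotientMap pt :=
  IsQuotientMap.of_surjective_continuous pt_surjective continuous_pt

/-- The homogenization of degree `d` of `p`. -/
def hom (p : ℂ[X]) (d : ℕ) (v : ℂ × ℂ) : ℂ :=
  ∑ k ∈ Finset.range (d + 1), p.coeff k * v.1 ^ k * v.2 ^ (d - k)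

theorem hom_of_snd_ne {p : ℂ[X]} {d : ℕ} (hp : p.natDegree ≤ d) {a b : ℂ} (hb : b ≠ 0) :
    hom p d (a, b) = b ^ d * p.eval (a / b) := by
  rw [hom, eval_eq_sum_range' (Nat.lt_succ_of_le hp), Finset.mul_sum]
  refine Finset.sum_congr rfl fun k hk => ?_
  have hk : k ≤ d := Nat.lt_succ_iff.1 (Finset.mem_range.1 hk)
  obtain ⟨m, rfl⟩ := Nat.exists_eq_add_of_le hk
  simp only [add_tsub_cancel_left, div_pow]
  field_simp
  ring

theorem hom_zero_right (p : ℂ[X]) (d : ℕ) (a : ℂ) : hom p d (a, 0) = p.coeff d * a ^ d := by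
  rw [hom, Finset.sum_eq_single d]
  · simp
  · intro k hk hkd
    have : d - k ≠ 0 := by
      have := Finset.mem_range.1 hk
      omega
    simp [this]
  · simp

theorem continuous_hom (p : ℂ[X]) (d : ℕ) : Continuous (hom p d) := by
  unfold hom
  fun_prop

theorem num_le (R : RatFunc ℂ) : R.num.natDegree ≤ degree R := le_max_left _ _
theorem denom_le (R : RatFunc ℂ) : R.denom.natDegree ≤ degree R := le_max_right _ _

theorem eval_ne (R : RatFunc ℂ) (x : ℂ) : (R.num.eval x, R.denom.eval x) ≠ (0, 0) := by
  intro h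
  obtain ⟨u, v, huv⟩ := R.isCoprime_num_denom
  have := congrArg (eval x) huv
  simp only [Prod.mk.injEq] at h
  simp [h.1, h.2] at this

theorem coeff_ne (R : RatFunc ℂ) :
    (R.num.coeff (degree R), R.denom.coeff (degree R)) ≠ (0, 0) := by
  intro h
  simp only [Prod.mk.injEq] at h
  rcases le_total R.num.natDegree R.denom.natDegree with hle | hle
  · have hd : degree R = R.denom.natDegree := max_eq_right hle
    rw [hd] at h
    exact R.denom_ne_zero (leadingCoeff_eq_zero.1 h.2)
  · have hd : degree R = R.num.natDegree := max_eq_left hle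
    rw [hd] at h
    have h0 : R.num = 0 := leadingCoeff_eq_zero.1 h.1
    rw [h0] at h hle
    have : R.denom.natDegree = 0 := by simpa using hle
    have h2 : R.denom.leadingCoeff = 0 := by
      rw [leadingCoeff, this]; simpa using h.2
    exact R.denom_ne_zero (leadingCoeff_eq_zero.1 h2)

/-- Values of numerator and denominator in homogeneous coordinates. -/
theorem hom_ne (R : RatFunc ℂ) {v : ℂ × ℂ} (hv : v ≠ (0, 0)) :
    (hom R.num (degree R) v, hom R.denom (degree R) v) ≠ (0, 0) := by
  obtain ⟨a, b⟩ := v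
  intro h
  simp only [Prod.mk.injEq] at h
  by_cases hb : b = 0
  · subst hb
    have ha : a ≠ 0 := by rintro rfl; simp at hv
    rw [hom_zero_right, hom_zero_right] at h
    apply coeff_ne R
    simpa [ha] using h
  · rw [hom_of_snd_ne (num_le R) hb, hom_of_snd_ne (denom_le R) hb] at h
    apply eval_ne R (a / b)
    simpa [hb] using h

theorem toMap_ratio (R : RatFunc ℂ) {a b : ℂ} (hv : (a, b) ≠ (0, 0)) :
    toMap R (ratio a b) =
      ratio (hom R.num (degree R) (a, b)) (hom R.denom (degree R) (a, b)) := by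
  by_cases hb : b = 0
  · subst hb
    have ha : a ≠ 0 := by rintro rfl; simp at hv
    rw [hom_zero_right, hom_zero_right, mul_comm _ (a ^ _), mul_comm _ (a ^ _),
      ratio_smul (pow_ne_zero _ ha)]
    simp [toMap, ratio]
  · rw [hom_of_snd_ne (num_le R) hb, hom_of_snd_ne (denom_le R) hb,
      ratio_smul (pow_ne_zero _ hb)]
    conv_lhs => rw [ratio, if_neg hb]
    rfl

theorem continuous_toMap (R : RatFunc ℂ) : Continuous (toMap R) := by
  rw [isQuotientMap_pt.continuous_iff, continuous_iff_continuousAt]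
  intro v
  have h1 : toMap R ∘ pt = (fun w : ℂ × ℂ => ratio w.1 w.2) ∘
      fun v : Unit2 => (hom R.num (degree R) v.1, hom R.denom (degree R) v.1) := by
    funext w
    exact toMap_ratio R w.ne
  rw [h1]
  refine ContinuousAt.comp (continuousAt_ratio (hom_ne R v.ne)) ?_
  exact (((continuous_hom _ _).comp continuous_subtype_val).prodMk
    ((continuous_hom _ _).comp continuous_subtype_val)).continuousAt

/-! ### Weighted sums over the fibres of a rational map -/

/-- The polynomial `q P - p Q`, whose zeros form the fibre over `[p : q]`. -/
def fibrePoly (R : RatFunc ℂ) (w : ℂ × ℂ) : ℂ[X] := C w.2 * R.num - C w.1 * R.denom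

/-- The linear form vanishing at the point `v`, dehomogenized. -/
def lin (v : ℂ × ℂ) : ℂ[X] := C v.2 * X - C v.1

theorem natDegree_fibrePoly_le (R : RatFunc ℂ) (w : ℂ × ℂ) :
    (fibrePoly R w).natDegree ≤ degree R := by
  refine (natDegree_sub_le _ _).trans (max_le ?_ ?_)
  · exact (natDegree_C_mul_le _ _).trans (num_le R)
  · exact (natDegree_C_mul_le _ _).trans (denom_le R)

theorem fibrePoly_ne_zero {R : RatFunc ℂ} (hR : 0 < degree R) {w : ℂ × ℂ} (hw : w ≠ (0, 0)) :
    fibrePoly R w ≠ 0 := by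
  intro h
  obtain ⟨u, v, huv⟩ := R.isCoprime_num_denom
  have h' : C w.2 * R.num = C w.1 * R.denom := sub_eq_zero.1 h
  have hd : degree R = 0 := by
    by_cases h2 : w.2 = 0
    · have h1 : w.1 ≠ 0 := by
        intro h1; exact hw (Prod.ext h1 h2)
      rw [h2, C_0, zero_mul] at h'
      have : R.denom = 0 := by
        rcases mul_eq_zero.1 h'.symm with h3 | h3
        · exact absurd (C_eq_zero.1 h3) h1
        · exact h3
      exact absurd this R.denom_ne_zero
    · have hn : R.num = C (w.1 / w.2) * R.denom := by
        have : C w.2⁻¹ * (C w.2 * R.num) = C w.2⁻¹ * (C w.1 * R.denom) := by rw [h']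
        rw [← mul_assoc, ← mul_assoc, ← C_mul, ← C_mul, inv_mul_cancel₀ h2, C_1, one_mul] at this
        rw [this, div_eq_mul_inv, mul_comm w.1]
      have hu : IsUnit R.denom := by
        refine IsUnit.of_mul_eq_one (u * C (w.1 / w.2) + v) ?_
        rw [← huv, hn]; ring
      have hden : R.denom.natDegree = 0 := natDegree_eq_zero_of_isUnit hu
      have hnum : R.num.natDegree = 0 := by
        have := natDegree_C_mul_le (w.1 / w.2) R.denom
        rw [← hn] at this; omega
      simp [degree, hden, hnum]
  omega

theorem natDegree_lin_le (v : ℂ × ℂ) : (lin v).natDegree ≤ 1 := by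
  unfold lin
  refine (natDegree_sub_le _ _).trans (max_le ?_ ?_)
  · exact (natDegree_C_mul_le _ _).trans natDegree_X_le
  · simp

theorem lin_ne_zero {v : ℂ × ℂ} (hv : v ≠ (0, 0)) : lin v ≠ 0 := by
  intro h
  have h0 := congrArg (fun p => coeff p 0) h
  have h1 := congrArg (fun p => coeff p 1) h
  simp [lin, coeff_C] at h0 h1
  exact hv (Prod.ext h0 h1)

theorem natDegree_prod_lin_le {d : ℕ} (v : Fin d → Unit2) :
    (∏ i, lin (v i).1).natDegree ≤ d := by
  refine (natDegree_prod_le _ _).trans ?_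
  calc ∑ i : Fin d, (lin (v i).1).natDegree ≤ ∑ _i : Fin d, 1 :=
        Finset.sum_le_sum fun i _ => natDegree_lin_le _
    _ = d := by simp

theorem prod_lin_ne_zero {d : ℕ} (v : Fin d → Unit2) : ∏ i, lin (v i).1 ≠ 0 :=
  Finset.prod_ne_zero_iff.2 fun i _ => lin_ne_zero (v i).ne

/-- Every nonzero polynomial of degree at most `d` is a multiple of a product of `d` linear
forms. -/
theorem exists_factor (d : ℕ) : ∀ F : ℂ[X], F ≠ 0 → F.natDegree ≤ d →
    ∃ (v : Fin d → Unit2) (c : ℂ), c ≠ 0 ∧ ∏ i, lin (v i).1 = C c * F := by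
  induction d with
  | zero =>
    intro F hF hd
    rw [Nat.le_zero, natDegree_eq_zero] at hd
    obtain ⟨a, rfl⟩ := hd
    have ha : a ≠ 0 := by rintro rfl; simp at hF
    exact ⟨Fin.elim0, a⁻¹, inv_ne_zero ha, by simp [← C_mul, ha]⟩
  | succ d ih =>
    intro F hF hd
    by_cases hle : F.natDegree ≤ d
    · obtain ⟨v, c, hc, hv⟩ := ih F hF hle
      refine ⟨Fin.cons ⟨(-1, 0), by simp [Prod.norm_def]⟩ v, c, hc, ?_⟩
      rw [Fin.prod_univ_succ]
      simp only [Fin.cons_zero, Fin.cons_succ, hv]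
      simp [lin]
    · have hpos : F.degree ≠ 0 := by
        intro h
        exact hle ((natDegree_eq_of_degree_eq_some (n := 0) h).trans_le (Nat.zero_le d))
      obtain ⟨r, hr⟩ := IsAlgClosed.exists_root F hpos
      obtain ⟨G, hG⟩ := dvd_iff_isRoot.2 hr
      have hG0 : G ≠ 0 := by rintro rfl; simp [hG] at hF
      have hGd : G.natDegree ≤ d := by
        have : F.natDegree = 1 + G.natDegree := by
          rw [hG, natDegree_mul (X_sub_C_ne_zero r) hG0, natDegree_X_sub_C]
        omega
      obtain ⟨v, c, hc, hv⟩ := ih G hG0 hGd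
      obtain ⟨u, t, ht, h1, h2⟩ := exists_unit2 (a := r) (b := 1) (by simp)
      refine ⟨Fin.cons u v, t * c, mul_ne_zero ht hc, ?_⟩
      rw [Fin.prod_univ_succ]
      simp only [Fin.cons_zero, Fin.cons_succ, hv]
      simp only [lin, h1, h2, hG, C_mul, mul_one]
      ring

/-- The points `v` list the fibre of `R` over `[w.1 : w.2]` with multiplicities. -/
def IsFibre (R : RatFunc ℂ) (w : ℂ × ℂ) (v : Fin (degree R) → Unit2) : Prop :=
  ∀ j k, (fibrePoly R w).coeff j * (∏ i, lin (v i).1).coeff k =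
    (fibrePoly R w).coeff k * (∏ i, lin (v i).1).coeff j

theorem isFibre_iff {R : RatFunc ℂ} (hR : 0 < degree R) {w : ℂ × ℂ} (hw : w ≠ (0, 0))
    {v : Fin (degree R) → Unit2} :
    IsFibre R w v ↔ ∃ c : ℂ, c ≠ 0 ∧ ∏ i, lin (v i).1 = C c * fibrePoly R w := by
  constructor
  · intro h
    have hF := fibrePoly_ne_zero hR hw
    obtain ⟨k, hk⟩ : ∃ k, (fibrePoly R w).coeff k ≠ 0 := by
      by_contra! hcon
      exact hF (Polynomial.ext (by simpa using hcon))
    have he : ∏ i, lin (v i).1 =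
        C ((∏ i, lin (v i).1).coeff k / (fibrePoly R w).coeff k) * fibrePoly R w := by
      ext j
      rw [coeff_C_mul]
      field_simp
      linear_combination h k j
    refine ⟨_, ?_, he⟩
    intro h0
    rw [h0] at he
    exact prod_lin_ne_zero v (by simpa using he)
  · rintro ⟨c, -, hc⟩ j k
    simp only [hc, coeff_C_mul]
    ring

theorem rootMultiplicity_C_mul {c : ℂ} (hc : c ≠ 0) (p : ℂ[X]) (x : ℂ) :
    (C c * p).rootMultiplicity x = p.rootMultiplicity x := by
  by_cases hp : p = 0
  · simp [hp]
  · rw [rootMultiplicity_mul (mul_ne_zero (C_ne_zero.2 hc) hp), rootMultiplicity_C, zero_add]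

theorem rootMultiplicity_prod {ι : Type*} (s : Finset ι) (f : ι → ℂ[X]) (x : ℂ)
    (h : ∀ i ∈ s, f i ≠ 0) :
    (∏ i ∈ s, f i).rootMultiplicity x = ∑ i ∈ s, (f i).rootMultiplicity x := by
  classical
  induction s using Finset.induction_on with
  | empty => simp [← C_1, -map_one]
  | insert a s ha ih =>
    have h1 : ∏ i ∈ s, f i ≠ 0 :=
      Finset.prod_ne_zero_iff.2 fun i hi => h i (Finset.mem_insert_of_mem hi)
    rw [Finset.prod_insert ha, Finset.sum_insert ha,
      rootMultiplicity_mul (mul_ne_zero (h a (Finset.mem_insert_self a s)) h1),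
      ih fun i hi => h i (Finset.mem_insert_of_mem hi)]

theorem rootMultiplicity_lin {a b : ℂ} (hv : (a, b) ≠ (0, 0)) (x : ℂ) :
    (C b * X - C a).rootMultiplicity x = if a = x * b then 1 else 0 := by
  by_cases hb : b = 0
  · have ha : a ≠ 0 := by rintro rfl; simp [hb] at hv
    have : (C b * X - C a : ℂ[X]) = C (-a) := by simp [hb]
    rw [this, rootMultiplicity_C]
    simp [hb, ha]
  · have : (C b * X - C a : ℂ[X]) = C b * (X - C (a / b)) := by
      rw [mul_sub, ← C_mul, mul_div_cancel₀ _ hb]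
    rw [this, rootMultiplicity_C_mul hb, rootMultiplicity_X_sub_C]
    congr 1
    rw [eq_div_iff hb]
    exact propext eq_comm

theorem reflect_lin (v : ℂ × ℂ) : (lin v).reflect 1 = C v.2 - C v.1 * X := by
  have h1 : (C v.2 * X : ℂ[X]).reflect 1 = C v.2 := by
    have := reflect_C_mul_X_pow 1 1 (c := v.2)
    simp
  have h2 : (C v.1 : ℂ[X]).reflect 1 = C v.1 * X := by
    simp
  rw [lin, reflect_sub, h1, h2]

theorem reflect_prod_lin {ι : Type*} (s : Finset ι) (v : ι → ℂ × ℂ) :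
    (∏ i ∈ s, lin (v i)).natDegree ≤ s.card ∧
    (∏ i ∈ s, lin (v i)).reflect s.card = ∏ i ∈ s, (C (v i).2 - C (v i).1 * X) := by
  classical
  induction s using Finset.induction_on with
  | empty => simp
  | insert a s ha ih =>
    rw [Finset.prod_insert ha, Finset.prod_insert ha, Finset.card_insert_of_notMem ha, add_comm]
    refine ⟨natDegree_mul_le.trans (add_le_add (natDegree_lin_le _) ih.1), ?_⟩
    rw [reflect_mul _ _ (natDegree_lin_le _) ih.1, reflect_lin, ih.2]

open Classical in
theorem branchIndex_eq_card {R : RatFunc ℂ} (hR : 0 < degree R) {w : ℂ × ℂ} (hw : w ≠ (0, 0))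
    {v : Fin (degree R) → Unit2} (hv : IsFibre R w v) {x : Sphere}
    (hx : toMap R x = ratio w.1 w.2) :
    branchIndex R x = (Finset.univ.filter fun i => pt (v i) = x).card := by
  obtain ⟨c, hc, hprod⟩ := (isFibre_iff hR hw).1 hv
  rw [Finset.card_filter]
  induction x using OnePoint.rec with
  | coe x =>
    obtain ⟨t, ht, h1, h2⟩ := exists_smul_of_ratio_eq (eval_ne R x) hw hx
    have e1 : branchIndex R (x : Sphere) = (C t * fibrePoly R w).rootMultiplicity x := by
      change (C (R.denom.eval x) * R.num - C (R.num.eval x) * R.denom).rootMultiplicity x = _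
      rw [h1, h2, fibrePoly, C_mul, C_mul]
      congr 1
      ring
    rw [e1, rootMultiplicity_C_mul ht, ← rootMultiplicity_C_mul hc, ← hprod,
      rootMultiplicity_prod _ _ _ fun i _ => lin_ne_zero (v i).ne]
    refine Finset.sum_congr rfl fun i _ => ?_
    rw [lin, rootMultiplicity_lin (v i).ne]
    have : (x : Sphere) = ratio x 1 := by simp [ratio]
    rw [pt, this, ratio_eq_iff (v i).ne (by simp), mul_one]
  | infty =>
    obtain ⟨t, ht, h1, h2⟩ := exists_smul_of_ratio_eq (coeff_ne R) hw hx
    have e1 : branchIndex R ∞ =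
        (C t * (fibrePoly R w).reflect (degree R)).rootMultiplicity 0 := by
      change (C (R.denom.coeff (degree R)) * R.num.reflect (degree R) -
        C (R.num.coeff (degree R)) * R.denom.reflect (degree R)).rootMultiplicity 0 = _
      rw [h1, h2, fibrePoly, C_mul, C_mul, reflect_sub, reflect_C_mul, reflect_C_mul]
      congr 1
      ring
    have hr := (reflect_prod_lin Finset.univ fun i => (v i).1).2
    rw [Finset.card_univ, Fintype.card_fin] at hr
    rw [e1, rootMultiplicity_C_mul ht, ← rootMultiplicity_C_mul hc, ← reflect_C_mul, ← hprod,
      hr]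
    have hl : ∀ i, (C (v i).1.2 - C (v i).1.1 * X : ℂ[X]) =
        C (-1) * (C (v i).1.1 * X - C (v i).1.2) := by
      intro i; simp
    have hsw : ∀ i, ((v i).1.2, (v i).1.1) ≠ ((0, 0) : ℂ × ℂ) := by
      intro i h
      simp only [Prod.mk.injEq] at h
      exact (v i).ne (Prod.ext h.2 h.1)
    have hm : (-1 : ℂ) ≠ 0 := by simp
    have hne : ∀ i ∈ Finset.univ, (C (v i).1.2 - C (v i).1.1 * X : ℂ[X]) ≠ 0 := by
      intro i _
      have h1 : lin ((v i).1.2, (v i).1.1) ≠ 0 := lin_ne_zero (hsw i)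
      have h2 : (C (-1) : ℂ[X]) ≠ 0 := C_ne_zero.2 hm
      rw [lin] at h1
      rw [hl i]
      exact mul_ne_zero h2 h1
    refine (rootMultiplicity_prod Finset.univ _ 0 hne).trans ?_
    refine Finset.sum_congr rfl fun i _ => ?_
    rw [hl, rootMultiplicity_C_mul hm, rootMultiplicity_lin (hsw i)]
    have h10 : ((1 : ℂ), (0 : ℂ)) ≠ (0, 0) := by simp
    have hinf : (∞ : Sphere) = ratio 1 0 := by simp [ratio]
    have hiff : pt (v i) = ∞ ↔ (v i).1.2 = 0 * (v i).1.1 := by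
      rw [pt, hinf, ratio_eq_iff (v i).ne h10]
      simp [eq_comm]
    simp only [hiff]

theorem eval_lin_self {v : ℂ × ℂ} (h : v.2 ≠ 0) : (lin v).eval (v.1 / v.2) = 0 := by
  simp [lin, mul_div_cancel₀ _ h]

theorem coeff_prod_lin {ι : Type*} (s : Finset ι) (v : ι → ℂ × ℂ) :
    (∏ i ∈ s, lin (v i)).coeff s.card = ∏ i ∈ s, (v i).2 := by
  have := coeff_prod_of_natDegree_le s (fun i => lin (v i)) 1 fun i _ => natDegree_lin_le _
  rw [mul_one] at this
  rw [this]
  refine Finset.prod_congr rfl fun i _ => ?_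
  simp [lin, coeff_C]

theorem toMap_pt_of_isFibre {R : RatFunc ℂ} (hR : 0 < degree R) {w : ℂ × ℂ} (hw : w ≠ (0, 0))
    {v : Fin (degree R) → Unit2} (hv : IsFibre R w v) (i : Fin (degree R)) :
    toMap R (pt (v i)) = ratio w.1 w.2 := by
  obtain ⟨c, hc, hprod⟩ := (isFibre_iff hR hw).1 hv
  by_cases hb : (v i).1.2 = 0
  · have h1 : pt (v i) = ∞ := by simp [pt, ratio, hb]
    have h2 := coeff_prod_lin Finset.univ fun i => (v i).1
    rw [Finset.card_univ, Fintype.card_fin, Finset.prod_eq_zero (f := fun i => (v i).1.2) (Finset.mem_univ i) hb, hprod,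
      coeff_C_mul] at h2
    have h3 : (fibrePoly R w).coeff (degree R) = 0 := by simpa [hc] using h2
    rw [h1]
    change ratio (R.num.coeff (degree R)) (R.denom.coeff (degree R)) = _
    rw [ratio_eq_iff (coeff_ne R) hw]
    rw [fibrePoly, coeff_sub, coeff_C_mul, coeff_C_mul] at h3
    linear_combination h3
  · have h1 : pt (v i) = (((v i).1.1 / (v i).1.2 : ℂ) : Sphere) := by simp [pt, ratio, hb]
    have h2 : (∏ i, lin (v i).1).eval ((v i).1.1 / (v i).1.2) = 0 := by
      rw [eval_prod]
      exact Finset.prod_eq_zero (Finset.mem_univ i) (eval_lin_self hb)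
    rw [hprod, eval_C_mul] at h2
    have h3 : (fibrePoly R w).eval ((v i).1.1 / (v i).1.2) = 0 := by simpa [hc] using h2
    rw [h1]
    change ratio (R.num.eval _) (R.denom.eval _) = _
    rw [ratio_eq_iff (eval_ne R _) hw]
    rw [fibrePoly, eval_sub, eval_C_mul, eval_C_mul] at h3
    linear_combination h3

theorem exists_isFibre {R : RatFunc ℂ} (hR : 0 < degree R) {w : ℂ × ℂ} (hw : w ≠ (0, 0)) :
    ∃ v, IsFibre R w v := by
  obtain ⟨v, c, hc, h⟩ := exists_factor (degree R) (fibrePoly R w) (fibrePoly_ne_zero hR hw)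
    (natDegree_fibrePoly_le R w)
  exact ⟨v, (isFibre_iff hR hw).2 ⟨c, hc, h⟩⟩

theorem branchIndex_pos {R : RatFunc ℂ} (hR : 0 < degree R) (x : Sphere) :
    0 < branchIndex R x := by
  induction x using OnePoint.rec with
  | coe x =>
    have h : (C (R.denom.eval x) * R.num - C (R.num.eval x) * R.denom) ≠ 0 :=
      fibrePoly_ne_zero (w := (R.num.eval x, R.denom.eval x)) hR (eval_ne R x)
    refine (rootMultiplicity_pos h).2 ?_
    simp [mul_comm]
  | infty =>
    have h : (fibrePoly R (R.num.coeff (degree R), R.denom.coeff (degree R))) ≠ 0 :=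
      fibrePoly_ne_zero hR (coeff_ne R)
    change 0 < (C (R.denom.coeff (degree R)) * R.num.reflect (degree R) -
      C (R.num.coeff (degree R)) * R.denom.reflect (degree R)).rootMultiplicity 0
    rw [← reflect_C_mul, ← reflect_C_mul, ← reflect_sub]
    refine (rootMultiplicity_pos (by simpa only [ne_eq, reflect_eq_zero_iff, fibrePoly] using h)).2 ?_
    rw [IsRoot, ← coeff_zero_eq_eval_zero, coeff_reflect, revAt_le (Nat.zero_le _)]
    simp [mul_comm]

open Classical in
theorem finite_fibre {R : RatFunc ℂ} (hR : 0 < degree R) (y : Sphere) :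
    {x | toMap R x = y}.Finite := by
  obtain ⟨w, rfl⟩ := pt_surjective y
  obtain ⟨v, hv⟩ := exists_isFibre hR w.ne
  refine (Set.finite_range fun i => pt (v i)).subset ?_
  intro x hx
  have h := branchIndex_pos hR x
  rw [branchIndex_eq_card hR w.ne hv hx, Finset.card_pos] at h
  obtain ⟨i, hi⟩ := h
  exact ⟨i, (Finset.mem_filter.1 hi).2⟩

/-- Summation over the fibre, counted with branch index. -/
theorem sum_fibre {R : RatFunc ℂ} (hR : 0 < degree R) {w : ℂ × ℂ} (hw : w ≠ (0, 0))
    {v : Fin (degree R) → Unit2} (hv : IsFibre R w v) (h : Sphere → ℂ) :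
    ∑ x ∈ (finite_fibre hR (ratio w.1 w.2)).toFinset, (branchIndex R x : ℂ) * h x =
      ∑ i, h (pt (v i)) := by
  classical
  rw [← Finset.sum_fiberwise_of_maps_to (s := Finset.univ)
    (t := (finite_fibre hR (ratio w.1 w.2)).toFinset) (g := fun i => pt (v i))]
  · refine Finset.sum_congr rfl fun x hx => ?_
    have hx : toMap R x = ratio w.1 w.2 := by simpa using hx
    rw [branchIndex_eq_card hR hw hv hx,
      Finset.sum_congr rfl (g := fun _ => h x) fun i hi => by rw [(Finset.mem_filter.1 hi).2],
      Finset.sum_const, nsmul_eq_mul]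
  · intro i _
    simpa using toMap_pt_of_isFibre hR hw hv i

theorem continuous_coeff_prod {ι Y : Type*} [TopologicalSpace Y] (s : Finset ι)
    (f : ι → Y → ℂ[X]) (hf : ∀ i ∈ s, ∀ k, Continuous fun y => (f i y).coeff k) (k : ℕ) :
    Continuous fun y => (∏ i ∈ s, f i y).coeff k := by
  classical
  induction s using Finset.induction_on generalizing k with
  | empty => simpa using continuous_const
  | insert a s ha ih =>
    simp only [Finset.prod_insert ha, coeff_mul]
    refine continuous_finsetSum _ fun p _ => ?_
    exact (hf a (Finset.mem_insert_self a s) _).mul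
      (ih (fun i hi => hf i (Finset.mem_insert_of_mem hi)) _)

theorem continuous_sum_fibre {R : RatFunc ℂ} (hR : 0 < degree R) {h : Sphere → ℂ}
    (hh : Continuous h) :
    Continuous fun y => ∑ x ∈ (finite_fibre hR y).toFinset, (branchIndex R x : ℂ) * h x := by
  let Z : Set (Unit2 × (Fin (degree R) → Unit2)) := {z | IsFibre R z.1.1 z.2}
  have hZ : IsClosed Z := by
    have : Z = ⋂ (j : ℕ) (k : ℕ), {z : Unit2 × (Fin (degree R) → Unit2) |
        (fibrePoly R z.1.1).coeff j * (∏ i, lin (z.2 i).1).coeff k =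
        (fibrePoly R z.1.1).coeff k * (∏ i, lin (z.2 i).1).coeff j} := by
      ext z; simp [Z, IsFibre]
    rw [this]
    refine isClosed_iInter fun j => isClosed_iInter fun k => ?_
    have c1 : ∀ j, Continuous fun z : Unit2 × (Fin (degree R) → Unit2) =>
        (fibrePoly R z.1.1).coeff j := by
      intro j
      simp only [fibrePoly, coeff_sub, coeff_C_mul]
      fun_prop
    have c2 : ∀ k, Continuous fun z : Unit2 × (Fin (degree R) → Unit2) =>
        (∏ i, lin (z.2 i).1).coeff k := by
      intro k
      refine continuous_coeff_prod _ (fun i (z : Unit2 × (Fin (degree R) → Unit2)) =>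
        lin (z.2 i).1) (fun i _ k => ?_) k
      simp only [lin, coeff_sub, coeff_C_mul, coeff_C]
      have : Continuous fun z : Unit2 × (Fin (degree R) → Unit2) => (z.2 i).1 := by fun_prop
      by_cases hk : k = 0
      · simp only [hk, if_true]; fun_prop
      · simp only [hk, if_false]; fun_prop
    exact isClosed_eq ((c1 j).mul (c2 k)) ((c1 k).mul (c2 j))
  have : CompactSpace Z := isCompact_iff_compactSpace.1 hZ.isCompact
  have hpc : Continuous fun z : Z => pt z.1.1 := continuous_pt.comp (by fun_prop)
  have hps : Function.Surjective fun z : Z => pt z.1.1 := by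
    intro y
    obtain ⟨w, rfl⟩ := pt_surjective y
    obtain ⟨v, hv⟩ := exists_isFibre hR w.ne
    exact ⟨⟨(w, v), hv⟩, rfl⟩
  have hq : IsQuotientMap fun z : Z => pt z.1.1 :=
    IsQuotientMap.of_surjective_continuous hps hpc
  rw [hq.continuous_iff]
  have : ((fun y => ∑ x ∈ (finite_fibre hR y).toFinset, (branchIndex R x : ℂ) * h x) ∘
      fun z : Z => pt z.1.1) = fun z : Z => ∑ i, h (pt (z.1.2 i)) := by
    funext z
    exact sum_fibre hR z.1.1.ne z.2 h
  rw [this]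
  refine continuous_finsetSum _ fun i _ => hh.comp (continuous_pt.comp ?_)
  fun_prop

theorem sum_branchIndex {R : RatFunc ℂ} (hR : 0 < degree R) (y : Sphere) :
    ∑ x ∈ (finite_fibre hR y).toFinset, branchIndex R x = degree R := by
  obtain ⟨w, rfl⟩ := pt_surjective y
  obtain ⟨v, hv⟩ := exists_isFibre hR w.ne
  have := sum_fibre hR w.ne hv fun _ => 1
  simp only [mul_one, Finset.sum_const, Finset.card_univ, Fintype.card_fin, nsmul_eq_mul] at this
  exact_mod_cast this

theorem isOpenMap_toMap {R : RatFunc ℂ} (hR : 0 < degree R) : IsOpenMap (toMap R) := by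
  rw [isOpenMap_iff_nhds_le]
  intro x U hU
  obtain ⟨V, hV, hVo, hxV⟩ := mem_nhds_iff.1 (Filter.mem_map.1 hU)
  obtain ⟨f, hf0, hf1, hf2⟩ := exists_continuous_zero_one_of_isClosed
    (hVo.isClosed_compl) (isClosed_singleton (x := x)) (by simpa using hxV)
  have hc := continuous_sum_fibre hR (h := fun x => ((f x : ℝ) : ℂ)) (by fun_prop)
  have hne : (∑ x' ∈ (finite_fibre hR (toMap R x)).toFinset,
      (branchIndex R x' : ℂ) * ((f x' : ℝ) : ℂ)) ≠ 0 := by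
    have hpos : 0 < ∑ x' ∈ (finite_fibre hR (toMap R x)).toFinset,
        (branchIndex R x' : ℝ) * f x' := by
      refine Finset.sum_pos' (fun x' _ => mul_nonneg (Nat.cast_nonneg _) (hf2 x').1)
        ⟨x, by simp, ?_⟩
      rw [hf1 (Set.mem_singleton x)]
      simpa using branchIndex_pos hR x
    intro h0
    exact hpos.ne' (by exact_mod_cast h0)
  have hev := hc.continuousAt.eventually_ne hne
  filter_upwards [hev] with y hy
  obtain ⟨x', hx', hne'⟩ := Finset.exists_ne_zero_of_sum_ne_zero hy
  have h1 : toMap R x' = y := by simpa using hx'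
  have h2 : x' ∈ V := by
    by_contra h
    have := hf0 h
    simp [this] at hne'
  rw [← h1]
  exact hV h2

/-! ### Fatou and Julia sets -/

/-- The Fatou set: the largest open set on which the iterates of `R` are equicontinuous, for the
unique uniform structure of the compact Hausdorff space `Sphere`. -/
def fatouSet (R : RatFunc ℂ) : Set Sphere :=
  letI : UniformSpace Sphere := uniformSpaceOfCompactR1
  ⋃₀ {U | IsOpen U ∧ EquicontinuousOn (fun n : ℕ => (toMap R)^[n]) U}

/-- The Julia set: the complement of the Fatou set. -/
def juliaSet (R : RatFunc ℂ) : Set Sphere := (fatouSet R)ᶜ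

theorem mem_fatouSet {R : RatFunc ℂ} {x : Sphere} :
    letI : UniformSpace Sphere := uniformSpaceOfCompactR1
    x ∈ fatouSet R ↔ ∃ U, IsOpen U ∧ x ∈ U ∧
      ∀ u ∈ U, EquicontinuousAt (fun n : ℕ => (toMap R)^[n]) u := by
  let _ : UniformSpace Sphere := uniformSpaceOfCompactR1
  constructor
  · rintro ⟨U, ⟨hU, hE⟩, hx⟩
    refine ⟨U, hU, hx, fun u hu V hV => ?_⟩
    have := hE u hu V hV
    rwa [hU.nhdsWithin_eq hu] at this
  · rintro ⟨U, hU, hx, hE⟩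
    exact ⟨U, ⟨hU, fun u hu => (hE u hu).equicontinuousWithinAt U⟩, hx⟩

theorem isClosed_juliaSet (R : RatFunc ℂ) : IsClosed (juliaSet R) := by
  rw [juliaSet, isClosed_compl_iff]
  exact isOpen_sUnion fun U hU => hU.1

/-- `R⁻¹(F_R) ⊆ F_R`, that is, `R(J_R) ⊆ J_R`. -/
theorem toMap_mem_juliaSet {R : RatFunc ℂ} {x : Sphere} (hx : x ∈ juliaSet R) :
    toMap R x ∈ juliaSet R := by
  let _ : UniformSpace Sphere := uniformSpaceOfCompactR1
  intro hF
  apply hx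
  obtain ⟨U, hU, hxU, hE⟩ := mem_fatouSet.1 hF
  refine mem_fatouSet.2 ⟨toMap R ⁻¹' U, hU.preimage (continuous_toMap R), hxU, ?_⟩
  intro u hu V hV
  have h1 := (continuous_toMap R).continuousAt.eventually (hE _ hu V hV)
  have h2 : ∀ᶠ x in 𝓝 u, (u, x) ∈ V := UniformSpace.mem_nhds_iff.2 ⟨V, hV, fun _ h => h⟩
  filter_upwards [h1, h2] with y hy hy' n
  cases n with
  | zero => exact hy'
  | succ n => exact hy n

/-- `R(F_R) ⊆ F_R`, that is, `R⁻¹(J_R) ⊆ J_R`. -/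
theorem mem_juliaSet_of_toMap_mem {R : RatFunc ℂ} (hR : 0 < degree R) {x : Sphere}
    (hx : toMap R x ∈ juliaSet R) : x ∈ juliaSet R := by
  let _ : UniformSpace Sphere := uniformSpaceOfCompactR1
  intro hF
  apply hx
  obtain ⟨U, hU, hxU, hE⟩ := mem_fatouSet.1 hF
  refine mem_fatouSet.2 ⟨toMap R '' U, isOpenMap_toMap hR U hU, ⟨x, hxU, rfl⟩, ?_⟩
  rintro _ ⟨u, hu, rfl⟩ V hV
  have h1 := (isOpenMap_toMap hR).image_mem_nhds (hE u hu V hV)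
  filter_upwards [h1]
  rintro _ ⟨y, hy, rfl⟩ n
  exact hy (n + 1)

/-- The Julia set as a compact space. -/
abbrev Julia (R : RatFunc ℂ) : Type := juliaSet R

instance (R : RatFunc ℂ) : CompactSpace (Julia R) :=
  isCompact_iff_compactSpace.1 (isClosed_juliaSet R).isCompact

/-- The restriction of `R` to its Julia set. -/
def juliaMap (R : RatFunc ℂ) : C(Julia R, Julia R) where
  toFun x := ⟨toMap R x, toMap_mem_juliaSet x.2⟩
  continuous_toFun := ((continuous_toMap R).comp continuous_subtype_val).subtype_mk _

/-! ### The transfer operator -/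

theorem finite_juliaFibre {R : RatFunc ℂ} (hR : 0 < degree R) (y : Julia R) :
    Finite {x : Julia R // juliaMap R x = y} := by
  have := (finite_fibre hR (y : Sphere)).to_subtype
  refine Finite.of_injective
    (fun x => (⟨x.1.1, congrArg Subtype.val x.2⟩ : {x | toMap R x = (y : Sphere)})) ?_
  intro x x' h
  exact Subtype.ext (Subtype.ext (Subtype.mk.inj h))

theorem juliaSum_eq {R : RatFunc ℂ} (hR : 0 < degree R) (y : Julia R) (h : Sphere → ℂ) :
    ∑ᶠ x : {x : Julia R // juliaMap R x = y}, (branchIndex R x.1 : ℂ) * h x.1 =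
      ∑ x ∈ (finite_fibre hR (y : Sphere)).toFinset, (branchIndex R x : ℂ) * h x := by
  have := finite_juliaFibre hR y
  have := Fintype.ofFinite {x : Julia R // juliaMap R x = y}
  rw [finsum_eq_sum_of_fintype]
  refine Finset.sum_bij (fun x _ => (x.1 : Sphere)) ?_ ?_ ?_ ?_
  · intro x _
    exact (Set.Finite.mem_toFinset _).2 (congrArg Subtype.val x.2)
  · intro x _ x' _ h
    exact Subtype.ext (Subtype.ext h)
  · intro x hx
    have hx : toMap R x = y := by simpa using hx
    exact ⟨⟨⟨x, mem_juliaSet_of_toMap_mem hR (hx ▸ y.2)⟩, Subtype.ext hx⟩, Finset.mem_univ _, rfl⟩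
  · intro x _
    rfl

theorem continuous_juliaSum {R : RatFunc ℂ} (hR : 0 < degree R) (a : C(Julia R, ℂ)) :
    Continuous fun y : Julia R =>
      ∑ᶠ x : {x : Julia R // juliaMap R x = y}, (branchIndex R x.1 : ℂ) * a x.1 := by
  obtain ⟨h, hh⟩ := a.exists_restrict_eq (isClosed_juliaSet R)
  have : (fun y : Julia R =>
      ∑ᶠ x : {x : Julia R // juliaMap R x = y}, (branchIndex R x.1 : ℂ) * a x.1) =
      fun y : Julia R => ∑ x ∈ (finite_fibre hR (y : Sphere)).toFinset,
        (branchIndex R x : ℂ) * h x := by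
    funext y
    rw [← juliaSum_eq hR]
    refine finsum_congr fun x => ?_
    rw [← hh]
    rfl
  rw [this]
  exact (continuous_sum_fibre hR h.continuous).comp continuous_subtype_val

theorem norm_juliaSum_le {R : RatFunc ℂ} (hR : 0 < degree R) {h : Julia R → ℂ} {M : ℝ}
    (hM : ∀ x, ‖h x‖ ≤ M) (y : Julia R) :
    ‖∑ᶠ x : {x : Julia R // juliaMap R x = y}, (branchIndex R x.1 : ℂ) * h x.1‖ ≤
      degree R * M := by
  have := finite_juliaFibre hR y
  have := Fintype.ofFinite {x : Julia R // juliaMap R x = y}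
  have h1 := juliaSum_eq hR y fun _ => 1
  simp only [mul_one] at h1
  rw [finsum_eq_sum_of_fintype] at h1 ⊢
  have h2 : ∑ x : {x : Julia R // juliaMap R x = y}, (branchIndex R x.1 : ℝ) = degree R := by
    have h3 := sum_branchIndex hR (y : Sphere)
    rw [← h3]
    exact_mod_cast h1
  calc _ ≤ ∑ x : {x : Julia R // juliaMap R x = y}, (branchIndex R x.1 : ℝ) * M := by
        refine norm_sum_le_of_le _ fun x _ => ?_
        rw [norm_mul, Complex.norm_natCast]
        exact mul_le_mul_of_nonneg_left (hM _) (Nat.cast_nonneg _)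
    _ = degree R * M := by rw [← Finset.sum_mul, h2]

/-- The transfer operator `E_R(a)(y) = (1 / deg R) ∑_{x ∈ R⁻¹(y)} e(x) a(x)` on `C(J_R)`. -/
def transfer {R : RatFunc ℂ} (hR : 0 < degree R) : C(Julia R, ℂ) →L[ℂ] C(Julia R, ℂ) :=
  LinearMap.mkContinuous
    { toFun := fun a =>
        { toFun := fun y => (1 / degree R : ℂ) *
            ∑ᶠ x : {x : Julia R // juliaMap R x = y}, (branchIndex R x.1 : ℂ) * a x.1
          continuous_toFun := continuous_const.mul (continuous_juliaSum hR a) }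
      map_add' := fun a b => by
        ext y
        have := finite_juliaFibre hR y
        simp only [ContinuousMap.coe_mk, ContinuousMap.add_apply, mul_add]
        rw [finsum_add_distrib (Set.toFinite _) (Set.toFinite _), mul_add]
      map_smul' := fun c a => by
        ext y
        have := finite_juliaFibre hR y
        simp only [ContinuousMap.coe_mk, ContinuousMap.smul_apply, smul_eq_mul,
          RingHom.id_apply]
        rw [mul_left_comm c, mul_finsum _ c]
        congr 1
        exact finsum_congr fun x => by ring }
    1 fun a => by
      rw [one_mul, ContinuousMap.norm_le _ (norm_nonneg a)]
      intro y
      have hd : (0 : ℝ) < degree R := by exact_mod_cast hR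
      have := norm_juliaSum_le hR (h := a) a.norm_coe_le_norm y
      simp only [LinearMap.coe_mk, AddHom.coe_mk, ContinuousMap.coe_mk]
      rw [norm_mul, norm_div, norm_one, Complex.norm_natCast, one_div, inv_mul_le_iff₀ hd]
      exact this

open scoped ComplexOrder in
theorem juliaSum_nonneg {R : RatFunc ℂ} (y : Julia R) {h : Julia R → ℂ} (h0 : ∀ x, 0 ≤ h x) :
    0 ≤ ∑ᶠ x : {x : Julia R // juliaMap R x = y}, (branchIndex R x.1 : ℂ) * h x.1 :=
  finsum_nonneg fun x => mul_nonneg (by exact_mod_cast Nat.zero_le _) (h0 _)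

/-- `C(J_R)` with the endomorphism `α(a) = a ∘ R` and the transfer operator `E_R`. -/
def transferSystem {R : RatFunc ℂ} (hR : 0 < degree R) : TransferSystem C(Julia R, ℂ) where
  α := (ContinuousMap.compStarAlgHom' ℂ ℂ (juliaMap R)).toNonUnitalStarAlgHom
  L := transfer hR
  L_pos a := by
    open ComplexOrder in
    have h : 0 ≤ transfer hR (star a * a) := by
      intro y
      change 0 ≤ (1 / degree R : ℂ) *
        ∑ᶠ x : {x : Julia R // juliaMap R x = y}, (branchIndex R x.1 : ℂ) * (star a * a) x.1
      refine mul_nonneg ?_ (juliaSum_nonneg y fun x => star_mul_self_nonneg (a x))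
      rw [one_div, inv_nonneg]
      exact_mod_cast Nat.zero_le _
    exact CStarAlgebra.nonneg_iff_eq_star_mul_self.1 h
  L_α_mul a b := by
    ext y
    have := finite_juliaFibre hR y
    change (1 / degree R : ℂ) * ∑ᶠ x : {x : Julia R // juliaMap R x = y},
      (branchIndex R x.1 : ℂ) * (a (juliaMap R x.1) * b x.1) = a y * ((1 / degree R : ℂ) *
        ∑ᶠ x : {x : Julia R // juliaMap R x = y}, (branchIndex R x.1 : ℂ) * b x.1)
    rw [mul_left_comm (a y), mul_finsum _ (a y)]
    congr 1
    refine finsum_congr fun x => ?_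
    rw [x.2]
    ring

/-! ### The Hilbert bimodule of a rational function -/

/-- The graph of `R` restricted to its Julia set. -/
abbrev Graph (R : RatFunc ℂ) : Type := {p : Julia R × Julia R // p.2 = juliaMap R p.1}

instance (R : RatFunc ℂ) : CompactSpace (Graph R) :=
  isCompact_iff_compactSpace.1
    (isClosed_eq continuous_snd ((juliaMap R).continuous.comp continuous_fst)).isCompact

/-- The point `(x, R(x))` of the graph. -/
def toGraph (R : RatFunc ℂ) : C(Julia R, Graph R) where
  toFun x := ⟨(x, juliaMap R x), rfl⟩
  continuous_toFun := (continuous_id.prodMk (juliaMap R).continuous).subtype_mk _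

/-- `X = C(graph R|_{J_R})`, which will be given the norm coming from its `C(J_R)`-valued inner
product. -/
def GraphModule {R : RatFunc ℂ} (_hR : 0 < degree R) : Type := C(Graph R, ℂ)

namespace GraphModule

variable {R : RatFunc ℂ} (hR : 0 < degree R)

instance : AddCommGroup (GraphModule hR) := inferInstanceAs (AddCommGroup C(Graph R, ℂ))
instance : Module ℂ (GraphModule hR) := inferInstanceAs (Module ℂ C(Graph R, ℂ))
instance : FunLike (GraphModule hR) (Graph R) ℂ := inferInstanceAs (FunLike C(Graph R, ℂ) _ _)
instance : ContinuousMapClass (GraphModule hR) (Graph R) ℂ :=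
  inferInstanceAs (ContinuousMapClass C(Graph R, ℂ) _ _)

/-- A continuous function on the graph, as an element of the module. -/
def mk : C(Graph R, ℂ) ≃ₗ[ℂ] GraphModule hR := LinearEquiv.refl ℂ C(Graph R, ℂ)

variable {hR}

@[simp] theorem mk_apply (f : C(Graph R, ℂ)) (p : Graph R) : mk hR f p = f p := rfl
@[simp] theorem add_apply (f g : GraphModule hR) (p : Graph R) : (f + g) p = f p + g p := rfl
@[simp] theorem smul_apply (c : ℂ) (f : GraphModule hR) (p : Graph R) : (c • f) p = c * f p := rfl
@[simp] theorem zero_apply (p : Graph R) : (0 : GraphModule hR) p = 0 := rfl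

theorem ext {f g : GraphModule hR} (h : ∀ p, f p = g p) : f = g := DFunLike.ext f g h

/-- The right multiplication `(f b)(x, y) = f(x, y) b(y)`. -/
instance : SMul C(Julia R, ℂ) (GraphModule hR) where
  smul b f := mk hR ⟨fun p => f p * b p.1.2, (map_continuous f).mul
    (b.continuous.comp (continuous_snd.comp continuous_subtype_val))⟩

/-- The inner product `(f | g)(y) = ∑_{x ∈ R⁻¹(y)} e(x) conj(f(x, y)) g(x, y)`. -/
instance : Inner C(Julia R, ℂ) (GraphModule hR) where
  inner f g :=
    { toFun := fun y => ∑ᶠ x : {x : Julia R // juliaMap R x = y},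
        (branchIndex R x.1 : ℂ) * (star (f ⟨(x.1, y), x.2.symm⟩) * g ⟨(x.1, y), x.2.symm⟩)
      continuous_toFun := by
        have := continuous_juliaSum hR
          ⟨fun x => star (f (toGraph R x)) * g (toGraph R x),
            ((map_continuous f).comp (toGraph R).continuous).star.mul
              ((map_continuous g).comp (toGraph R).continuous)⟩
        refine this.congr fun y => finsum_congr fun x => ?_
        obtain ⟨x, rfl⟩ := x
        rfl }

instance : Norm (GraphModule hR) := CStarModule.norm C(Julia R, ℂ)

theorem op_smul_apply (b : C(Julia R, ℂ)) (f : GraphModule hR) (p : Graph R) :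
    (b • f) p = f p * b p.1.2 := rfl

theorem inner_apply (f g : GraphModule hR) (y : Julia R) :
    (inner C(Julia R, ℂ) f g) y = ∑ᶠ x : {x : Julia R // juliaMap R x = y},
      (branchIndex R x.1 : ℂ) * (star (f ⟨(x.1, y), x.2.symm⟩) * g ⟨(x.1, y), x.2.symm⟩) := rfl

theorem norm_def (f : GraphModule hR) : ‖f‖ = √‖inner C(Julia R, ℂ) f f‖ := rfl

section

open scoped ComplexOrder

theorem term_nonneg (f : GraphModule hR) {y : Julia R} (x : {x : Julia R // juliaMap R x = y}) :
    0 ≤ (branchIndex R x.1 : ℂ) *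
      (star (f ⟨(x.1, y), x.2.symm⟩) * f ⟨(x.1, y), x.2.symm⟩) :=
  mul_nonneg (by exact_mod_cast Nat.zero_le _) (star_mul_self_nonneg _)

/-- A single term of the sum defining `(f | f)(y)`. -/
theorem term_le (f : GraphModule hR) (p : Graph R) :
    star (f p) * f p ≤ (inner C(Julia R, ℂ) f f) p.1.2 := by
  obtain ⟨⟨x, y⟩, hp⟩ := p
  have := finite_juliaFibre hR y
  have := Fintype.ofFinite {x : Julia R // juliaMap R x = y}
  have hp : y = juliaMap R x := hp
  rw [inner_apply, finsum_eq_sum_of_fintype]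
  refine le_trans ?_ (Finset.single_le_sum (fun x _ => term_nonneg f x)
    (Finset.mem_univ (⟨x, hp.symm⟩ : {x : Julia R // juliaMap R x = y})))
  refine le_mul_of_one_le_left (star_mul_self_nonneg _) ?_
  exact_mod_cast branchIndex_pos hR _

instance : CStarModule C(Julia R, ℂ) (GraphModule hR) where
  inner_add_right {f g h} := by
    ext y
    have := finite_juliaFibre hR y
    simp only [ContinuousMap.add_apply, inner_apply, add_apply, mul_add]
    exact finsum_add_distrib (Set.toFinite _) (Set.toFinite _)
  inner_self_nonneg {f} := fun y => finsum_nonneg fun x => term_nonneg f x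
  inner_self {f} := by
    constructor
    · intro h
      refine ext fun p => ?_
      have h1 := term_le f p
      rw [h] at h1
      have h2 := le_antisymm h1 (star_mul_self_nonneg _)
      simpa using h2
    · rintro rfl
      ext y
      simp [inner_apply]
  inner_op_smul_right {b f g} := by
    ext y
    have := finite_juliaFibre hR y
    rw [ContinuousMap.mul_apply, inner_apply, inner_apply, mul_finsum]
    refine finsum_congr fun x => ?_
    rw [op_smul_apply]
    ring
  inner_smul_right_complex {c f g} := by
    ext y
    have := finite_juliaFibre hR y
    rw [ContinuousMap.smul_apply, inner_apply, inner_apply, smul_eq_mul,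
      mul_finsum]
    refine finsum_congr fun x => ?_
    rw [smul_apply]
    ring
  star_inner f g := by
    ext y
    have := finite_juliaFibre hR y
    have := Fintype.ofFinite {x : Julia R // juliaMap R x = y}
    rw [ContinuousMap.star_apply, inner_apply, inner_apply, finsum_eq_sum_of_fintype,
      finsum_eq_sum_of_fintype, star_sum]
    refine Finset.sum_congr rfl fun x _ => ?_
    rw [star_mul', star_mul', star_star, star_natCast, mul_comm (f _)]
  norm_eq_sqrt_norm_inner_self f := rfl

instance : NormedAddCommGroup (GraphModule hR) :=
  NormedAddCommGroup.ofCore (CStarModule.normedSpaceCore C(Julia R, ℂ))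

instance : NormedSpace ℂ (GraphModule hR) :=
  NormedSpace.ofCore (CStarModule.normedSpaceCore C(Julia R, ℂ))

theorem norm_apply_le (f : GraphModule hR) (p : Graph R) : ‖f p‖ ≤ ‖f‖ := by
  rw [norm_def]
  refine Real.le_sqrt_of_sq_le ?_
  have h1 := CStarAlgebra.norm_le_norm_of_nonneg_of_le (star_mul_self_nonneg (f p)) (term_le f p)
  rw [CStarRing.norm_star_mul_self, ← sq] at h1
  exact h1.trans (ContinuousMap.norm_coe_le_norm _ _)

theorem norm_le_of_forall {f : GraphModule hR} {M : ℝ} (hM : 0 ≤ M) (h : ∀ p, ‖f p‖ ≤ M) :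
    ‖f‖ ≤ √(degree R) * M := by
  rw [norm_def, Real.sqrt_le_left (by positivity), mul_pow, Real.sq_sqrt (Nat.cast_nonneg _),
    ContinuousMap.norm_le _ (by positivity)]
  intro y
  have h1 := norm_juliaSum_le hR (M := M ^ 2)
    (h := fun x => star (f (toGraph R x)) * f (toGraph R x)) (fun x => by
      rw [CStarRing.norm_star_mul_self, ← sq]
      exact pow_le_pow_left₀ (norm_nonneg _) (h _) 2) y
  have h2 : (inner C(Julia R, ℂ) f f) y = ∑ᶠ x : {x : Julia R // juliaMap R x = y},
      (branchIndex R x.1 : ℂ) * (star (f (toGraph R x)) * f (toGraph R x)) := by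
    rw [inner_apply]
    refine finsum_congr fun x => ?_
    obtain ⟨x, rfl⟩ := x
    rfl
  rw [h2]
  exact h1

/-- The Hilbert module norm is equivalent to the supremum norm. -/
def mkL : C(Graph R, ℂ) ≃L[ℂ] GraphModule hR :=
  (mk hR).toContinuousLinearEquivOfBounds (√(degree R)) 1
    (fun f => norm_le_of_forall (norm_nonneg f) f.norm_coe_le_norm)
    (fun f => by
      rw [one_mul, ContinuousMap.norm_le _ (norm_nonneg f)]
      exact norm_apply_le f)

instance : CompleteSpace (GraphModule hR) :=
  (completeSpace_congr (e := (mkL (hR := hR)).toEquiv) mkL.isUniformEmbedding).1 inferInstance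

end

end GraphModule

/-- The left multiplication `(φ(a) f)(x, y) = a(x) f(x, y)` on `X = C(graph R|_{J_R})`. -/
def leftMul {R : RatFunc ℂ} (hR : 0 < degree R) (a : C(Julia R, ℂ)) :
    GraphModule hR →L[ℂ] GraphModule hR :=
  LinearMap.mkContinuous
    { toFun := fun f => GraphModule.mk hR ⟨fun p => a p.1.1 * f p,
        (a.continuous.comp (continuous_fst.comp continuous_subtype_val)).mul
          (map_continuous f)⟩
      map_add' := fun f g => GraphModule.ext fun p => mul_add _ _ _
      map_smul' := fun c f => GraphModule.ext fun p => mul_left_comm _ _ _ }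
    (√(degree R) * ‖a‖) fun f => by
      rw [mul_assoc]
      refine GraphModule.norm_le_of_forall (by positivity) fun p => ?_
      refine (norm_mul_le _ _).trans ?_
      exact mul_le_mul (a.norm_coe_le_norm _) (GraphModule.norm_apply_le f p)
        (norm_nonneg _) (norm_nonneg _)

theorem leftMul_apply {R : RatFunc ℂ} {hR : 0 < degree R} (a : C(Julia R, ℂ))
    (f : GraphModule hR) (p : Graph R) : leftMul hR a f p = a p.1.1 * f p := rfl

open scoped ComplexOrder in
/-- `X = C(graph R|_{J_R})` as a Hilbert bimodule over `C(J_R)`. -/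
def graphAction {R : RatFunc ℂ} (hR : 0 < degree R) :
    LeftAction C(Julia R, ℂ) (GraphModule hR) where
  φ := AlgHom.ofLinearMap
    { toFun := leftMul hR
      map_add' := fun a b => ContinuousLinearMap.ext fun f => GraphModule.ext fun p => by
        simp only [_root_.add_apply, GraphModule.add_apply, leftMul_apply,
          ContinuousMap.add_apply, add_mul]
      map_smul' := fun c a => ContinuousLinearMap.ext fun f => GraphModule.ext fun p => by
        simp only [_root_.smul_apply, GraphModule.smul_apply, leftMul_apply,
          ContinuousMap.smul_apply, smul_eq_mul, RingHom.id_apply, mul_assoc] }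
    (ContinuousLinearMap.ext fun f => GraphModule.ext fun p => one_mul (f p))
    (fun a b => ContinuousLinearMap.ext fun f => GraphModule.ext fun p =>
      mul_assoc (a p.1.1) (b p.1.1) (f p))
  inner_φ a f g := by
    refine ContinuousMap.ext fun y => ?_
    rw [AlgHom.ofLinearMap_apply, AlgHom.ofLinearMap_apply, LinearMap.coe_mk, AddHom.coe_mk,
      GraphModule.inner_apply, GraphModule.inner_apply]
    refine finsum_congr fun x => ?_
    rw [leftMul_apply, leftMul_apply, star_mul', ContinuousMap.star_apply]
    ring

open scoped ComplexOrder in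
/-- The C⋆-algebra `O_R`: the Cuntz–Pimsner algebra of the Hilbert bimodule
`C(graph R|_{J_R})` over `C(J_R)`. -/
abbrev RationalAlgebra {R : RatFunc ℂ} (hR : 0 < degree R) : Type :=
  CuntzPimsner (graphAction hR)

end

end JuliaAlgebra

open Polynomial Topology Filter

namespace JuliaAlgebra

noncomputable section

/-! ### The C⋆-identity for quotient norms. -/

section Quotient

universe u

/-! Projecting the graph to its first coordinate identifies X with A. The left action becomes
multiplication, the right action of b becomes multiplication by α(b), and the inner product becomes
(deg R) E_R(f̄ g). Hence the constant function 1 is cyclic for the left action. A copy of A together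
with V such that V a = α(a) V and V^* a V = E_R(a) gives a representation of the bimodule by S_f =
√(deg R) a V, where a(x) = f(x, R(x)); conversely V = S_1 / √(deg R). What remains is to match
Cuntz–Pimsner covariance with Exel's redundancies.

The products S_f S_g^* are deg R times elements of A S S^* A, and the equation in the definition of
a redundancy says k S_f = S_{φ(a) f} for all f. So if φ(a) is compact, then (a, i_K(φ(a))) is a
redundancy (`isCovariant_of_redundancy`). Conversely, f ↦ S_f is isometric in the Toeplitz algebra,
which makes i_K bounded below with closed range; then k = i_K(K) for some compact K, and K = φ(a)
(`redundancy_eq`). The isometry rests on injectivity of A → T(A, α, E_R), seen in a concrete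
representation on ℓ²(J_R) in which A multiplies and S is a weighted composition operator
(`exists_faithful_toeplitz`). Exel's restriction on a is vacuous because α(1) = 1. Both algebras
therefore have the same universal property, and `nonempty_equiv_of_universal` produces the mutually
inverse homomorphisms.

Two analytic facts support this. First, i_K exists for every representation of the Hilbert module,
because ‖∑ S_ξ S_η^*‖ ≤ ‖∑ θ_{ξ, η}‖ (`IsModuleRep.norm_snd_le`). Second, the crossed product, given
as an algebraic quotient, is a C⋆-algebra for the quotient norm (`exists_mem_norm_add_sq_le`), so
the universal property of O_R applies with it as target. -/

theorem TwoSidedIdeal.smul_mem_of_algebra {B : Type*} [Ring B] [Algebra ℂ B] (J : TwoSidedIdeal B)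
    (c : ℂ) {x : B} (hx : x ∈ J) : c • x ∈ J := by
  rw [Algebra.smul_def]
  exact J.mul_mem_left _ _ hx

/-- If `M + h` is strictly positive, conjugating by `(1 + h / M)^(-1/2)` sends it to `M`; the
conjugating element is congruent to `1` modulo the ideal generated by `h`. -/
theorem exists_conjugate_eq_algebraMap {B : Type u} [CStarAlgebra B] [PartialOrder B]
    [StarOrderedRing B] {h : B} (hh : 0 ≤ h) {M : ℝ} (hM : 0 < M) :
    ∃ g : B, IsSelfAdjoint (1 + h * g) ∧
      (1 + h * g) * (algebraMap ℝ B M + h) * (1 + h * g) = algebraMap ℝ B M := by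
  have hs : ∀ t ∈ spectrum ℝ h, 0 ≤ t := fun t ht => spectrum_nonneg_of_nonneg hh ht
  have hpos : ∀ t ∈ spectrum ℝ h, 0 < 1 + t / M := fun t ht => by
    have := div_nonneg (hs t ht) hM.le
    linarith
  let s : ℝ → ℝ := fun t => √(1 + t / M)
  have hsp : ∀ t ∈ spectrum ℝ h, 0 < s t := fun t ht => Real.sqrt_pos.2 (hpos t ht)
  have hsc : ContinuousOn s (spectrum ℝ h) := by fun_prop
  let w : ℝ → ℝ := fun t => (s t)⁻¹
  have hwc : ContinuousOn w (spectrum ℝ h) := hsc.inv₀ fun t ht => (hsp t ht).ne'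
  -- This is (w(t) - 1) / t, rewritten with t = M (s² - 1) so that the singularity at t = 0 cancels.
  -- Continuity there makes w(h) - 1 a multiple of h.
  let g : ℝ → ℝ := fun t => -(M * (s t * (1 + s t)))⁻¹
  have hgc : ContinuousOn g (spectrum ℝ h) := by
    refine ((continuousOn_const.mul (hsc.mul (continuousOn_const.add hsc))).inv₀ ?_).neg
    intro t ht
    have := hsp t ht
    have h3 : 0 < M * (s t * (1 + s t)) := by positivity
    exact h3.ne'
  have hsq : ∀ t ∈ spectrum ℝ h, s t ^ 2 = 1 + t / M := fun t ht => Real.sq_sqrt (hpos t ht).le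
  have hw : 1 + h * cfc g h = cfc w h := by
    have e1 : h * cfc g h = cfc (fun t => t * g t) h := by
      rw [cfc_mul (fun t => t) g h continuousOn_id hgc, cfc_id' ℝ h]
    have e2 : (1 : B) = cfc (fun _ : ℝ => (1 : ℝ)) h := by rw [cfc_const_one ℝ h]
    rw [e1, e2, ← cfc_add (a := h) (fun _ => (1 : ℝ)) (fun t => t * g t) continuousOn_const
      (continuousOn_id.mul hgc)]
    refine cfc_congr fun t ht => ?_
    have h1 := hsp t ht
    have h2 : t = M * (s t ^ 2 - 1) := by rw [hsq t ht]; field_simp; ring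
    have h3 : 1 + s t ≠ 0 := by positivity
    change 1 + t * g t = w t
    have : t * g t = (1 - s t) / s t := by
      simp only [g]
      nth_rewrite 1 [h2]
      field_simp
      ring
    rw [this]
    simp only [w]
    field_simp
    ring
  refine ⟨cfc g h, ?_, ?_⟩
  · rw [hw]; exact cfc_predicate w h
  · rw [hw]
    -- Since M + t = M s(t)² and w = 1 / s, the product w (M + t) w is the constant M on the
    -- spectrum.
    have e1 : algebraMap ℝ B M + h = cfc (fun t => M + t) h := by
      rw [cfc_const_add M (fun t => t) h continuousOn_id, cfc_id' ℝ h]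
    have hc : ContinuousOn (fun t : ℝ => M + t) (spectrum ℝ h) := by fun_prop
    rw [e1, ← cfc_mul w (fun t => M + t) h hwc hc,
      ← cfc_mul (fun t => w t * (M + t)) w h (hwc.mul hc) hwc,
      ← cfc_const M h]
    refine cfc_congr fun t ht => ?_
    have h1 := hsp t ht
    have h2 : t = M * (s t ^ 2 - 1) := by rw [hsq t ht]; field_simp; ring
    simp only [w]
    nth_rewrite 2 [h2]
    field_simp
    ring

/-- The C⋆-inequality for the quotient norm of a C⋆-algebra by a self-adjoint ideal. -/
theorem exists_mem_norm_add_sq_le {B : Type u} [CStarAlgebra B] (J : TwoSidedIdeal B)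
    (hJ : ∀ x ∈ J, star x ∈ J) {x j : B} (hj : j ∈ J) {M : ℝ} (hM : ‖star x * x + j‖ < M) :
    ∃ k ∈ J, ‖x + k‖ ^ 2 ≤ M := by
  let _ : PartialOrder B := CStarAlgebra.spectralOrder B
  let _ : StarOrderedRing B := CStarAlgebra.spectralOrderedRing B
  set N := ‖star x * x + j‖
  have hM0 : 0 < M := (norm_nonneg _).trans_lt hM
  obtain ⟨ε, hε, hNε⟩ : ∃ ε : ℝ, 0 < ε ∧ M = N + ε := ⟨M - N, by linarith, by ring⟩
  -- As x^* x is self-adjoint, j may be replaced by its self-adjoint part without increasing the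
  -- norm of the sum; this gives x^* x ≤ N - r.
  let r : B := (2⁻¹ : ℂ) • (j + star j)
  have hrJ : r ∈ J := TwoSidedIdeal.smul_mem_of_algebra J _ (J.add_mem hj (hJ j hj))
  have hrs : star r = r := by simp [r, add_comm]
  have hy : star x * x + r ≤ algebraMap ℝ B N := by
    have e : star x * x + r = (2⁻¹ : ℂ) • ((star x * x + j) + star (star x * x + j)) := by
      simp only [r, star_add, star_mul, star_star]
      module
    have hsa : IsSelfAdjoint (star x * x + r) := by
      simp [isSelfAdjoint_iff, hrs]
    refine hsa.le_algebraMap_norm_self.trans (algebraMap_mono B ?_)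
    have := norm_add_le (star x * x + j) (star (star x * x + j))
    rw [norm_star] at this
    rw [e, norm_smul, norm_inv, Complex.norm_ofNat]
    change _ ≤ N + N at this
    linarith
  -- Completing the square: ε + r + r² / (4ε) = ε⁻¹ (ε + r / 2)² ≥ 0, so -r ≤ ε + h. The possibly
  -- negative r is traded for a positive element of the ideal.
  let h : B := (4 * ε)⁻¹ • (star r * r)
  have hh : 0 ≤ h := smul_nonneg (by positivity) (star_mul_self_nonneg r)
  have hhJ : h ∈ J := by
    have : h = (((4 * ε)⁻¹ : ℝ) : ℂ) • (star r * r) := (RCLike.real_smul_eq_coe_smul (K := ℂ) _ _)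
    rw [this]
    exact TwoSidedIdeal.smul_mem_of_algebra J _ (J.mul_mem_left _ _ hrJ)
  have hle : star x * x ≤ algebraMap ℝ B M + h := by
    have h1 : 0 ≤ ε⁻¹ • (star (ε • (1 : B) + (2⁻¹ : ℝ) • r) * (ε • (1 : B) + (2⁻¹ : ℝ) • r)) :=
      smul_nonneg (by positivity) (star_mul_self_nonneg _)
    have h2 : ε⁻¹ • (star (ε • (1 : B) + (2⁻¹ : ℝ) • r) * (ε • (1 : B) + (2⁻¹ : ℝ) • r)) =
        ε • (1 : B) + r + h := by
      simp only [h, star_add, star_smul, star_one, hrs, add_mul, mul_add, smul_mul_smul_comm,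
        one_mul, mul_one, star_trivial, smul_add, smul_smul]
      have a1 : ε⁻¹ * (ε * ε) = ε := by field_simp
      have a2 : ε⁻¹ * (ε * 2⁻¹) = 2⁻¹ := by field_simp
      have a3 : ε⁻¹ * (2⁻¹ * ε) = 2⁻¹ := by field_simp
      have a4 : ε⁻¹ * (2⁻¹ * 2⁻¹) = (4 * ε)⁻¹ := by field_simp; norm_num
      rw [a1, a2, a3, a4]
      module
    rw [h2] at h1
    have h3 := add_le_add hy h1
    rw [hNε, map_add, Algebra.algebraMap_eq_smul_one (R := ℝ) ε]
    calc star x * x = (star x * x + r + 0) - r := by abel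
      _ ≤ (algebraMap ℝ B N + (ε • (1 : B) + r + h)) - r := sub_le_sub_right h3 _
      _ = _ := by abel
  -- Conjugation by 1 + h g turns x^* x ≤ M + h into a bound by M, while x (1 + h g) differs from x
  -- by an element of J.
  obtain ⟨g, hg, hgM⟩ := exists_conjugate_eq_algebraMap hh hM0
  refine ⟨x * (h * g), J.mul_mem_left _ _ (J.mul_mem_right _ _ hhJ), ?_⟩
  have e : x + x * (h * g) = x * (1 + h * g) := by rw [mul_add, mul_one]
  rw [e, sq, ← CStarRing.norm_star_mul_self, star_mul, hg.star_eq]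
  have h1 : (1 + h * g) * star x * (x * (1 + h * g)) ≤ algebraMap ℝ B M := by
    rw [← hgM]
    have := hg.conjugate_le_conjugate hle
    simpa only [mul_assoc] using this
  have h2 : 0 ≤ (1 + h * g) * star x * (x * (1 + h * g)) := by
    have := star_mul_self_nonneg (x * (1 + h * g))
    rwa [star_mul, hg.star_eq] at this
  refine (CStarAlgebra.norm_le_norm_of_nonneg_of_le h2 h1).trans ?_
  rcases subsingleton_or_nontrivial B with hB | hB
  · rw [Subsingleton.elim (algebraMap ℝ B M) 0, norm_zero]
    exact hM0.le
  · rw [norm_algebraMap', Real.norm_of_nonneg hM0.le]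

theorem isClosed_redundancyIdeal {A : Type u} [CStarAlgebra A] (D : TransferSystem A) :
    IsClosed (redundancyIdeal D : Set (ExelToeplitz D)) := by
  have : (redundancyIdeal D : Set (ExelToeplitz D)) =
      ⋂ I ∈ {I : TwoSidedIdeal (ExelToeplitz D) | IsClosed (I : Set (ExelToeplitz D)) ∧
        (∀ x ∈ I, star x ∈ I) ∧ ∀ a k, IsRedundancy D a k →
        a ∈ closure (Submodule.span ℂ (Set.range fun p : A × A × A =>
          p.1 * D.α p.2.1 * p.2.2) : Set A) → ExelToeplitz.ofA D a - k ∈ I},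
        (I : Set (ExelToeplitz D)) := by
    ext x
    rw [SetLike.mem_coe, redundancyIdeal, TwoSidedIdeal.mem_sInf]
    simp only [Set.mem_iInter, SetLike.mem_coe]
  rw [this]
  exact isClosed_biInter fun I hI => hI.1

theorem sub_mem_redundancyIdeal {A : Type u} [CStarAlgebra A] (D : TransferSystem A) {a : A}
    {k : ExelToeplitz D} (h : IsRedundancy D a k)
    (ha : a ∈ closure (Submodule.span ℂ (Set.range fun p : A × A × A =>
      p.1 * D.α p.2.1 * p.2.2) : Set A)) :
    ExelToeplitz.ofA D a - k ∈ redundancyIdeal D := by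
  rw [redundancyIdeal, TwoSidedIdeal.mem_sInf]
  exact fun I hI => hI.2.2 a k h ha

/-! ### Exel's crossed product as a C⋆-algebra. -/

namespace ExelCrossedProduct

variable {A : Type u} [CStarAlgebra A] (D : TransferSystem A)

/-- The quotient map from the Toeplitz algebra onto Exel's crossed product. -/
def mk : ExelToeplitz D →⋆ₐ[ℂ] ExelCrossedProduct D where
  toFun := (redundancyIdeal D).ringCon.mk'
  map_one' := rfl
  map_mul' _ _ := rfl
  map_zero' := rfl
  map_add' _ _ := rfl
  commutes' _ := rfl
  map_star' _ := rfl

theorem mk_surjective : Function.Surjective (mk D) := RingCon.mk'_surjective _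

theorem mk_eq_mk_iff {x y : ExelToeplitz D} : mk D x = mk D y ↔ x - y ∈ redundancyIdeal D :=
  (RingCon.eq _).trans (TwoSidedIdeal.rel_iff _ _ _)

theorem mk_eq_zero_iff {x : ExelToeplitz D} : mk D x = 0 ↔ x ∈ redundancyIdeal D := by
  rw [← map_zero (mk D), mk_eq_mk_iff, sub_zero]

/-- Closedness of the kernel is what makes the quotient seminorm a norm. -/
instance : IsClosed ((mk D : ExelToeplitz D →+ ExelCrossedProduct D).ker :
    Set (ExelToeplitz D)) := by
  have : ((mk D : ExelToeplitz D →+ ExelCrossedProduct D).ker : Set (ExelToeplitz D)) =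
      redundancyIdeal D := Set.ext fun x => mk_eq_zero_iff D
  rw [this]
  exact isClosed_redundancyIdeal D

/-- Exel's crossed product as a quotient of additive groups. -/
def quotientEquiv : ExelToeplitz D ⧸ (mk D : ExelToeplitz D →+ ExelCrossedProduct D).ker ≃+
    ExelCrossedProduct D :=
  QuotientAddGroup.quotientKerEquivOfSurjective _ (mk_surjective D)

instance : NormedAddCommGroup (ExelCrossedProduct D) :=
  NormedAddCommGroup.induced _ _ (quotientEquiv D).symm (quotientEquiv D).symm.injective

theorem norm_def (x : ExelCrossedProduct D) : ‖x‖ = ‖(quotientEquiv D).symm x‖ := rfl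

theorem norm_quotientEquiv
    (x : ExelToeplitz D ⧸ (mk D : ExelToeplitz D →+ ExelCrossedProduct D).ker) :
    ‖quotientEquiv D x‖ = ‖x‖ := by
  rw [norm_def, AddEquiv.symm_apply_apply]

theorem norm_mk_le (x : ExelToeplitz D) : ‖mk D x‖ ≤ ‖x‖ :=
  (norm_quotientEquiv D x).trans_le (QuotientAddGroup.norm_mk_le_norm)

/-- The quotient norm is an infimum over lifts; the product, scalar and C⋆ estimates below all use
it in this form. -/
theorem exists_mk_eq (x : ExelCrossedProduct D) {M : ℝ} (hM : ‖x‖ < M) :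
    ∃ t, mk D t = x ∧ ‖t‖ < M := by
  obtain ⟨y, rfl⟩ := (quotientEquiv D).surjective x
  rw [norm_quotientEquiv, QuotientAddGroup.norm_lt_iff] at hM
  obtain ⟨t, rfl, ht⟩ := hM
  exact ⟨t, rfl, ht⟩

theorem norm_mul_le (x y : ExelCrossedProduct D) : ‖x * y‖ ≤ ‖x‖ * ‖y‖ := by
  have h : ∀ ε > 0, ‖x * y‖ ≤ (‖x‖ + ε) * (‖y‖ + ε) := by
    intro ε hε
    obtain ⟨s, rfl, hs⟩ := exists_mk_eq D x (lt_add_of_pos_right _ hε)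
    obtain ⟨t, rfl, ht⟩ := exists_mk_eq D y (lt_add_of_pos_right _ hε)
    rw [← map_mul]
    refine (norm_mk_le D _).trans ((_root_.norm_mul_le _ _).trans ?_)
    exact mul_le_mul hs.le ht.le (norm_nonneg _) (by positivity)
  have hc : Tendsto (fun ε : ℝ => (‖x‖ + ε) * (‖y‖ + ε)) (𝓝[>] 0) (𝓝 (‖x‖ * ‖y‖)) := by
    have : Continuous fun ε : ℝ => (‖x‖ + ε) * (‖y‖ + ε) := by fun_prop
    simpa using (this.tendsto 0).mono_left nhdsWithin_le_nhds
  exact ge_of_tendsto hc (eventually_mem_nhdsWithin.mono h)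

theorem norm_smul_le (c : ℂ) (x : ExelCrossedProduct D) : ‖c • x‖ ≤ ‖c‖ * ‖x‖ := by
  have h : ∀ ε > 0, ‖c • x‖ ≤ ‖c‖ * (‖x‖ + ε) := by
    intro ε hε
    obtain ⟨s, rfl, hs⟩ := exists_mk_eq D x (lt_add_of_pos_right _ hε)
    rw [← map_smul]
    refine (norm_mk_le D _).trans ((_root_.norm_smul_le _ _).trans ?_)
    exact mul_le_mul_of_nonneg_left hs.le (norm_nonneg _)
  have hc : Tendsto (fun ε : ℝ => ‖c‖ * (‖x‖ + ε)) (𝓝[>] 0) (𝓝 (‖c‖ * ‖x‖)) := by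
    have : Continuous fun ε : ℝ => ‖c‖ * (‖x‖ + ε) := by fun_prop
    simpa using (this.tendsto 0).mono_left nhdsWithin_le_nhds
  exact ge_of_tendsto hc (eventually_mem_nhdsWithin.mono h)

instance : CompleteSpace (ExelCrossedProduct D) := by
  have h : IsUniformEmbedding (quotientEquiv D).symm :=
    (AddMonoidHomClass.isometry_of_norm (quotientEquiv D).symm fun _ => rfl).isUniformEmbedding
  exact (completeSpace_congr (e := (quotientEquiv D).symm.toEquiv) h).2 inferInstance

instance : NormedRing (ExelCrossedProduct D) where
  dist_eq := NormedAddGroup.dist_eq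
  norm_mul_le := norm_mul_le D

/-- If t lifts x, every lift of x^* x is t^* t + j with j in the ideal. By
`exists_mem_norm_add_sq_le`, a lift of x^* x of norm below M yields a lift t + k of x with ‖t + k‖²
≤ M. -/
instance : CStarRing (ExelCrossedProduct D) where
  norm_mul_self_le x := by
    rw [← sq]
    refine le_of_forall_gt_imp_ge_of_dense fun M hM => ?_
    obtain ⟨t, rfl⟩ := mk_surjective D x
    rw [← map_star, ← map_mul] at hM
    obtain ⟨u, hu, huM⟩ := exists_mk_eq D _ hM
    obtain ⟨k, hk, hkM⟩ := exists_mem_norm_add_sq_le (redundancyIdeal D)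
      (fun x hx => star_mem_redundancyIdeal D hx) (x := t) (j := u - star t * t)
      ((mk_eq_mk_iff D).1 hu) (M := M) (by rwa [add_sub_cancel])
    refine le_trans ?_ hkM
    have : mk D t = mk D (t + k) := by rw [map_add, (mk_eq_zero_iff D).2 hk, add_zero]
    rw [this]
    exact pow_le_pow_left₀ (norm_nonneg _) (norm_mk_le D _) 2

instance : CStarAlgebra (ExelCrossedProduct D) where
  norm_smul_le := norm_smul_le D

end ExelCrossedProduct

end Quotient

/-! ### Compact operators in a representation of a Hilbert module. -/

section HilbertModule

universe u

variable {A X : Type u} [CommCStarAlgebra A] [PartialOrder A] [StarOrderedRing A]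
  [NormedAddCommGroup X] [NormedSpace ℂ X] [SMul A X] [CStarModule A X]

/-- A representation of a Hilbert module in a C⋆-algebra. -/
structure IsModuleRep {B : Type u} [CStarAlgebra B] (i : A →⋆ₐ[ℂ] B) (S : X →ₗ[ℂ] B) : Prop where
  right : ∀ a ξ, S ξ * i a = S (a • ξ)
  star_mul : ∀ ξ η, star (S ξ) * S η = i (inner A ξ η)

/-- ‖T' y‖² = ‖(T T' y | y)‖ ≤ ‖T‖ ‖T' y‖ ‖y‖ by Cauchy–Schwarz; cancel ‖T' y‖. -/
theorem norm_le_of_adjoint {T T' : X →L[ℂ] X}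
    (h : ∀ x y, inner A (T x) y = inner A x (T' y)) : ‖T'‖ ≤ ‖T‖ := by
  refine T'.opNorm_le_bound (norm_nonneg _) fun y => ?_
  have h1 : ‖T' y‖ ^ 2 ≤ ‖T‖ * ‖T' y‖ * ‖y‖ := by
    rw [CStarModule.norm_sq_eq A, ← h]
    refine (CStarModule.norm_inner_le X).trans ?_
    exact mul_le_mul_of_nonneg_right (T.le_opNorm _) (norm_nonneg _)
  rcases (norm_nonneg (T' y)).eq_or_lt with h0 | h0
  · rw [← h0]; positivity
  · refine le_of_mul_le_mul_right ?_ h0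
    calc ‖T' y‖ * ‖T' y‖ = ‖T' y‖ ^ 2 := (sq _).symm
      _ ≤ ‖T‖ * ‖T' y‖ * ‖y‖ := h1
      _ = _ := by ring

/-- If b < a, dividing by a power of a leaves a ≤ C (b / a)^(2^m - 1), which tends to 0. The lemma
removes the uncontrolled constant from `IsModuleRep.exists_bound`; powers 2^m suffice because norms
of self-adjoint elements are multiplicative on them. -/
theorem le_of_pow_two_pow_le {a b C : ℝ} (hb : 0 ≤ b)
    (h : ∀ m : ℕ, a ^ 2 ^ m ≤ C * b ^ (2 ^ m - 1)) : a ≤ b := by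
  by_contra! hab
  have ha : 0 < a := hb.trans_lt hab
  have h1 : ∀ m : ℕ, a ≤ C * (b / a) ^ (2 ^ m - 1) := by
    intro m
    have h2 := h m
    obtain ⟨k, hk⟩ := Nat.exists_eq_add_of_le (Nat.one_le_two_pow (n := m))
    rw [hk, add_tsub_cancel_left] at h2 ⊢
    rw [add_comm, pow_succ] at h2
    rw [div_pow, mul_div_assoc', le_div_iff₀ (pow_pos ha _)]
    linarith
  have h2 : Tendsto (fun m : ℕ => 2 ^ m - 1) atTop atTop :=
    (tendsto_sub_atTop_nat 1).comp (tendsto_pow_atTop_atTop_of_one_lt (by norm_num))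
  have h3 : Tendsto (fun m : ℕ => C * (b / a) ^ (2 ^ m - 1)) atTop (𝓝 (C * 0)) :=
    ((tendsto_pow_atTop_nhds_zero_of_lt_one (by positivity)
      ((div_lt_one ha).2 hab)).comp h2).const_mul C
  have := ge_of_tendsto' h3 h1
  simp only [mul_zero] at this
  linarith

variable {B : Type u} [CStarAlgebra B] {i : A →⋆ₐ[ℂ] B} {S : X →ₗ[ℂ] B}

set_option linter.unusedSectionVars false in
theorem IsModuleRep.norm_le (h : IsModuleRep i S) (ξ : X) : ‖S ξ‖ ≤ ‖ξ‖ := by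
  have : ‖S ξ‖ ^ 2 ≤ ‖ξ‖ ^ 2 := by
    rw [sq, ← CStarRing.norm_star_mul_self, h.star_mul, CStarModule.norm_sq_eq A]
    exact NonUnitalStarAlgHom.norm_apply_le i _
  exact (pow_le_pow_iff_left₀ (norm_nonneg _) (norm_nonneg _) two_ne_zero).1 this

variable (A) in
/-- The span of the pairs `(θ_{ξ, η}, S_ξ S_η^*)`. -/
def rankOnePairs (S : X →ₗ[ℂ] B) : Submodule ℂ ((X →L[ℂ] X) × B) :=
  Submodule.span ℂ (Set.range fun p : X × X => (rankOne A p.1 p.2, S p.1 * star (S p.2)))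

theorem rankOne_apply (ξ η ζ : X) : rankOne A ξ η ζ = inner A η ζ • ξ := rfl

/-- S_ξ S_η^* S_ζ = S_ξ i((η | ζ)) = S_{ξ (η | ζ)}, and the relation is linear in the pair. Pairs
are used because θ_{ξ, η} ↦ S_ξ S_η^* is not yet known to be well defined on the span. -/
theorem IsModuleRep.snd_mul (h : IsModuleRep i S) {z : (X →L[ℂ] X) × B}
    (hz : z ∈ rankOnePairs A S) (ζ : X) : z.2 * S ζ = S (z.1 ζ) := by
  induction hz using Submodule.span_induction with
  | mem z hz =>
    obtain ⟨⟨ξ, η⟩, rfl⟩ := hz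
    simp only [rankOne_apply]
    rw [mul_assoc, h.star_mul, h.right]
  | zero => simp
  | add y z _ _ hy hz =>
    rw [Prod.snd_add, Prod.fst_add, add_mul, hy, hz, _root_.add_apply, map_add]
  | smul c z _ hz =>
    rw [Prod.smul_snd, Prod.smul_fst, smul_mul_assoc, hz, _root_.smul_apply, map_smul]

/-- The adjoint of θ_{ξ, η} is θ_{η, ξ}, matching (S_ξ S_η^*)^* = S_η S_ξ^*. A general bounded
operator on X need not be adjointable, so the adjoint is carried along the span. -/
theorem exists_star_mem_rankOnePairs {z : (X →L[ℂ] X) × B} (hz : z ∈ rankOnePairs A S) :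
    ∃ T' : X →L[ℂ] X, (T', star z.2) ∈ rankOnePairs A S ∧
      ∀ x y, inner A (z.1 x) y = inner A x (T' y) := by
  induction hz using Submodule.span_induction with
  | mem z hz =>
    obtain ⟨⟨ξ, η⟩, rfl⟩ := hz
    refine ⟨rankOne A η ξ, Submodule.subset_span ⟨(η, ξ), by simp⟩, fun x y => ?_⟩
    simp only [rankOne_apply]
    rw [CStarModule.inner_op_smul_right, CStarModule.inner_op_smul_left, CStarModule.star_inner,
      mul_comm]
  | zero => exact ⟨0, by rw [Prod.snd_zero, star_zero]; exact zero_mem _, by simp⟩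
  | add y z _ _ hy hz =>
    obtain ⟨T, hT, hT'⟩ := hy
    obtain ⟨U, hU, hU'⟩ := hz
    refine ⟨T + U, ?_, fun x y => ?_⟩
    · have := add_mem hT hU
      rwa [Prod.mk_add_mk, ← star_add] at this
    · simp only [Prod.fst_add, _root_.add_apply, CStarModule.inner_add_left,
        CStarModule.inner_add_right, hT', hU']
  | smul c z _ hz =>
    obtain ⟨T, hT, hT'⟩ := hz
    refine ⟨star c • T, ?_, fun x y => ?_⟩
    · have := (rankOnePairs A S).smul_mem (star c) hT
      rwa [Prod.smul_mk, ← star_smul] at this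
    · simp only [Prod.smul_fst, _root_.smul_apply, CStarModule.inner_smul_left_complex,
        CStarModule.inner_smul_right_complex, hT']

/-- For a single pair, w S_ξ S_η^* = S_{W ξ} S_η^*. The constant depends on how the second component
is written as a sum, but not on W, and that is enough once high powers are taken. -/
theorem IsModuleRep.exists_bound (h : IsModuleRep i S) {z : (X →L[ℂ] X) × B}
    (hz : z ∈ rankOnePairs A S) :
    ∃ C, ∀ (W : X →L[ℂ] X) (w : B), (∀ ζ, w * S ζ = S (W ζ)) → ‖w * z.2‖ ≤ C * ‖W‖ := by
  induction hz using Submodule.span_induction with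
  | mem z hz =>
    obtain ⟨⟨ξ, η⟩, rfl⟩ := hz
    refine ⟨‖ξ‖ * ‖η‖, fun W w hw => ?_⟩
    simp only
    rw [← mul_assoc, hw]
    calc _ ≤ ‖S (W ξ)‖ * ‖star (S η)‖ := norm_mul_le _ _
      _ ≤ (‖W‖ * ‖ξ‖) * ‖η‖ := by
        rw [norm_star]
        exact mul_le_mul ((h.norm_le _).trans (W.le_opNorm _)) (h.norm_le _) (norm_nonneg _)
          (by positivity)
      _ = _ := by ring
  | zero => exact ⟨0, fun W w _ => by simp⟩
  | add y z _ _ hy hz =>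
    obtain ⟨C, hC⟩ := hy
    obtain ⟨D, hD⟩ := hz
    refine ⟨C + D, fun W w hw => ?_⟩
    rw [Prod.snd_add, mul_add, add_mul]
    exact (norm_add_le _ _).trans (add_le_add (hC W w hw) (hD W w hw))
  | smul c z _ hz =>
    obtain ⟨C, hC⟩ := hz
    refine ⟨‖c‖ * C, fun W w hw => ?_⟩
    rw [Prod.smul_snd, mul_smul_comm, norm_smul, mul_assoc]
    exact mul_le_mul_of_nonneg_left (hC W w hw) (norm_nonneg _)

/-- `‖∑ S_{ξ_j} S_{η_j}^*‖ ≤ ‖∑ θ_{ξ_j, η_j}‖`. -/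
theorem IsModuleRep.norm_snd_le (h : IsModuleRep i S) {z : (X →L[ℂ] X) × B}
    (hz : z ∈ rankOnePairs A S) : ‖z.2‖ ≤ ‖z.1‖ := by
  obtain ⟨T, t⟩ := z
  obtain ⟨T', hT', hadj⟩ := exists_star_mem_rankOnePairs hz
  obtain ⟨C, hC⟩ := h.exists_bound hz
  have hw : ∀ (n : ℕ) (ζ : X), (t * star t) ^ n * S ζ = S (((T * T') ^ n) ζ) := by
    intro n
    induction n with
    | zero => intro ζ; simp
    | succ n ih =>
      intro ζ
      rw [pow_succ, mul_assoc, mul_assoc, h.snd_mul hT', h.snd_mul hz, ih, pow_succ]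
      rfl
  have hn : ∀ n : ℕ, ‖(T * T') ^ n‖ ≤ (‖T‖ ^ 2) ^ n := by
    intro n
    induction n with
    | zero => rw [pow_zero, pow_zero]; exact ContinuousLinearMap.norm_id_le
    | succ n ih =>
      rw [pow_succ, pow_succ (‖T‖ ^ 2)]
      refine (norm_mul_le _ _).trans (mul_le_mul ih ?_ (norm_nonneg _) (by positivity))
      refine (norm_mul_le _ _).trans ?_
      rw [sq]
      exact mul_le_mul_of_nonneg_left (norm_le_of_adjoint hadj) (norm_nonneg _)
  have hC0 : 0 ≤ |C| := abs_nonneg C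
  -- With k = 2^m - 1, write (t t^*)^(2^m) = ((t t^*)^k t) t^*. The bound for w = (t t^*)^k and W =
  -- (T T')^k gives (‖t‖²)^(2^m) ≤ |C| ‖t‖ (‖T‖²)^k, and m → ∞ removes the constant.
  have hsq : ‖t‖ ^ 2 ≤ ‖T‖ ^ 2 := by
    refine le_of_pow_two_pow_le (C := |C| * ‖t‖) (by positivity) fun m => ?_
    obtain ⟨k, hk⟩ := Nat.exists_eq_add_of_le (Nat.one_le_two_pow (n := m))
    have e : (‖t‖ ^ 2) ^ 2 ^ m = ‖(t * star t) ^ 2 ^ m‖ := by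
      rw [(IsSelfAdjoint.mul_star_self t).norm_pow_two_pow, CStarRing.norm_self_mul_star, sq]
    rw [e, hk, add_tsub_cancel_left, add_comm, pow_succ, ← mul_assoc]
    have h1 : ‖(t * star t) ^ k * t‖ ≤ |C| * (‖T‖ ^ 2) ^ k :=
      (hC _ _ (hw k)).trans (mul_le_mul (le_abs_self C) (hn k) (norm_nonneg _) hC0)
    calc _ ≤ ‖(t * star t) ^ k * t‖ * ‖star t‖ := norm_mul_le _ _
      _ ≤ |C| * (‖T‖ ^ 2) ^ k * ‖t‖ := by
        rw [norm_star]
        exact mul_le_mul_of_nonneg_right h1 (norm_nonneg _)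
      _ = _ := by ring
  exact (pow_le_pow_iff_left₀ (norm_nonneg _) (norm_nonneg _) two_ne_zero).1 hsq

variable (A X) in
theorem fst_mem_compactOperators {S : X →ₗ[ℂ] B} {z : (X →L[ℂ] X) × B}
    (hz : z ∈ rankOnePairs A S) : z.1 ∈ compactOperators A X := by
  have : rankOnePairs A S ≤ (compactOperators A X).comap (LinearMap.fst ℂ _ _) := by
    refine Submodule.span_le.2 ?_
    rintro _ ⟨p, rfl⟩
    exact rankOne_mem A p.1 p.2
  exact this hz

/-- The map `K(X) → B` determined by a representation of `X` in `B`. -/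
theorem IsModuleRep.exists_compact (h : IsModuleRep i S) :
    ∃ iK : compactOperators A X →L[ℂ] B,
      (∀ ξ η, iK ⟨rankOne A ξ η, rankOne_mem A ξ η⟩ = S ξ * star (S η)) ∧
      (∀ T ζ, iK T * S ζ = S (T.1 ζ)) ∧
      ∀ T, iK T ∈ closure
        (Submodule.span ℂ (Set.range fun p : X × X => S p.1 * star (S p.2)) : Set B) := by
  let e : rankOnePairs A S →ₗ[ℂ] compactOperators A X :=
    LinearMap.codRestrict _ ((LinearMap.fst ℂ _ _).comp (rankOnePairs A S).subtype)
      fun z => fst_mem_compactOperators A X z.2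
  let f : rankOnePairs A S →ₗ[ℂ] B := (LinearMap.snd ℂ _ _).comp (rankOnePairs A S).subtype
  have hd : DenseRange e := by
    rw [DenseRange, Subtype.dense_iff]
    intro T hT
    refine closure_mono ?_ hT
    intro T hT
    have : Submodule.span ℂ (Set.range fun p : X × X => rankOne A p.1 p.2) ≤
        (rankOnePairs A S).map (LinearMap.fst ℂ _ _) := by
      refine Submodule.span_le.2 ?_
      rintro _ ⟨p, rfl⟩
      exact ⟨_, Submodule.subset_span ⟨p, rfl⟩, rfl⟩
    obtain ⟨z, hz, rfl⟩ := this hT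
    exact ⟨e ⟨z, hz⟩, ⟨_, rfl⟩, rfl⟩
  -- The norm inequality gives well-definedness and continuity together, so the second projection
  -- extends along the first, whose range is dense in the compact operators.
  have hb : ∃ C, ∀ z, ‖f z‖ ≤ C * ‖e z‖ :=
    ⟨1, fun z => (h.norm_snd_le z.2).trans_eq (one_mul _).symm⟩
  have : IsBoundedSMul ℂ (compactOperators A X) :=
    @NormedSpace.toIsBoundedSMul ℂ _ _ _ (Submodule.normedSpace _)
  have hE : ∀ z, f.extendOfNorm e (e z) = f z := LinearMap.extendOfNorm_eq hd hb
  have hS : Continuous S := AddMonoidHomClass.continuous_of_bound S 1 fun ξ => by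
    rw [one_mul]; exact h.norm_le ξ
  refine ⟨f.extendOfNorm e, fun ξ η => ?_, fun T ζ => ?_, fun T => ?_⟩
  · exact hE ⟨(rankOne A ξ η, S ξ * star (S η)), Submodule.subset_span ⟨(ξ, η), rfl⟩⟩
  · refine hd.induction_on (p := fun T => f.extendOfNorm e T * S ζ = S (T.1 ζ)) T ?_ ?_
    · refine isClosed_eq (by fun_prop) (hS.comp ?_)
      exact (ContinuousLinearMap.apply ℂ X ζ).continuous.comp continuous_subtype_val
    · intro z
      rw [hE]
      exact h.snd_mul z.2 ζ
  · refine hd.induction_on (p := fun T => f.extendOfNorm e T ∈ closure _) T ?_ ?_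
    · exact isClosed_closure.preimage (f.extendOfNorm e).continuous
    · intro z
      rw [hE]
      refine subset_closure ?_
      have : rankOnePairs A S ≤ (Submodule.span ℂ (Set.range fun p : X × X =>
          S p.1 * star (S p.2))).comap (LinearMap.snd ℂ _ _) := by
        refine Submodule.span_le.2 ?_
        rintro _ ⟨p, rfl⟩
        exact Submodule.subset_span ⟨p, rfl⟩
      exact this z.2

end HilbertModule

/-! ### Multiplication and weighted composition operators on ℓ². -/

section SquareSummable

open scoped ENNReal InnerProductSpace

universe u

/-- The Hilbert space of square summable functions. -/
abbrev SquareSummable (J : Type u) : Type u := lp (fun _ : J => ℂ) 2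

variable {J : Type u}

theorem SquareSummable.hasSum_norm_sq (f : SquareSummable J) :
    HasSum (fun x => ‖f x‖ ^ 2) (‖f‖ ^ 2) := by
  have := lp.hasSum_norm (p := 2) (by norm_num) f
  simpa using this

theorem memℓp_two_of_summable {f : J → ℂ} (h : Summable fun x => ‖f x‖ ^ 2) :
    Memℓp f 2 := memℓp_gen (by simpa using h)

/-- Multiplication by a bounded continuous function on `ℓ²`. -/
def multiplicationOperator [TopologicalSpace J] [CompactSpace J] (a : C(J, ℂ)) :
    SquareSummable J →L[ℂ] SquareSummable J :=
  LinearMap.mkContinuous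
    { toFun := fun f => ⟨fun x => a x * f x, ((lp.memℓp f).const_smul (‖a‖ : ℂ)).mono'
        fun x => by
          rw [Pi.smul_apply, norm_smul, norm_mul, Complex.norm_real, norm_norm]
          exact mul_le_mul_of_nonneg_right (a.norm_coe_le_norm x) (norm_nonneg _)⟩
      map_add' := fun f g => lp.ext (funext fun x => mul_add _ _ _)
      map_smul' := fun c f => lp.ext (funext fun x => mul_left_comm _ _ _) }
    ‖a‖ fun f => by
      have h : ‖a‖ * ‖f‖ = ‖(‖a‖ : ℂ) • f‖ := by
        rw [norm_smul, Complex.norm_real, norm_norm]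
      rw [h]
      refine lp.norm_mono two_ne_zero fun x => ?_
      have h1 : ‖((‖a‖ : ℂ) • f) x‖ = ‖a‖ * ‖f x‖ := by
        rw [lp.coeFn_smul, Pi.smul_apply, norm_smul, Complex.norm_real, norm_norm]
      refine le_trans ?_ h1.ge
      exact (norm_mul_le (a x) (f x)).trans
        (mul_le_mul_of_nonneg_right (a.norm_coe_le_norm x) (norm_nonneg _))

theorem multiplicationOperator_apply [TopologicalSpace J] [CompactSpace J] (a : C(J, ℂ))
    (f : SquareSummable J) (x : J) : multiplicationOperator a f x = a x * f x := rfl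

/-- The representation of `C(J)` on `ℓ²(J)` by multiplication operators. -/
def multiplicationRep (J : Type u) [TopologicalSpace J] [CompactSpace J] :
    C(J, ℂ) →⋆ₐ[ℂ] (SquareSummable J →L[ℂ] SquareSummable J) where
  toFun := multiplicationOperator
  map_one' := ContinuousLinearMap.ext fun f => lp.ext (funext fun x => one_mul _)
  map_mul' a b := ContinuousLinearMap.ext fun f => lp.ext (funext fun x => mul_assoc _ _ _)
  map_zero' := ContinuousLinearMap.ext fun f => lp.ext (funext fun x => zero_mul _)
  map_add' a b := ContinuousLinearMap.ext fun f => lp.ext (funext fun x => add_mul _ _ _)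
  commutes' c := ContinuousLinearMap.ext fun f => lp.ext (funext fun x => rfl)
  map_star' a := by
    rw [ContinuousLinearMap.star_eq_adjoint, ContinuousLinearMap.eq_adjoint_iff]
    intro f g
    rw [lp.inner_eq_tsum, lp.inner_eq_tsum]
    refine tsum_congr fun x => ?_
    rw [multiplicationOperator_apply, multiplicationOperator_apply, ContinuousMap.star_apply]
    simp only [RCLike.inner_apply, map_mul, RCLike.star_def, Complex.conj_conj]
    ring

theorem multiplicationRep_apply [TopologicalSpace J] [CompactSpace J] (a : C(J, ℂ))
    (f : SquareSummable J) (x : J) : multiplicationRep J a f x = a x * f x := rfl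

/-- Point masses lie in ℓ² and recover each value of the function, so no measure on the space has to
be chosen. -/
theorem multiplicationRep_injective [TopologicalSpace J] [CompactSpace J] :
    Function.Injective (multiplicationRep J) := by
  classical
  intro a b h
  ext x
  have h1 := congrArg (fun T : SquareSummable J →L[ℂ] SquareSummable J =>
    T (lp.single 2 x 1) x) h
  simpa [multiplicationRep_apply] using h1

variable {ρ : J → J} {p : J → ℝ}

theorem tsum_eq_tsum_finsum_fibre (hρ : ∀ y, Finite {x // ρ x = y}) {u : J → ℂ}
    (hu : Summable u) : ∑' x, u x = ∑' y, ∑ᶠ x : {x // ρ x = y}, u x.1 := by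
  rw [← (Equiv.sigmaFiberEquiv ρ).tsum_eq u]
  refine ((Equiv.sigmaFiberEquiv ρ).summable_iff.2 hu).tsum_sigma.trans ?_
  refine tsum_congr fun y => ?_
  have := hρ y
  exact tsum_eq_finsum (Set.toFinite _)

/-- On the fibre over y the summands are p(x) v(y), and the weights add up to 1. Nonnegativity
allows summability to be checked fibre by fibre. This is the isometry property of f ↦ √p (f ∘ ρ). -/
theorem hasSum_weight_mul_comp (hρ : ∀ y, Finite {x // ρ x = y}) (hp : ∀ x, 0 ≤ p x)
    (h1 : ∀ y, ∑ᶠ x : {x // ρ x = y}, p x.1 = 1) {v : J → ℝ} (hv : ∀ x, 0 ≤ v x) {s : ℝ}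
    (hs : HasSum v s) : HasSum (fun x => p x * v (ρ x)) s := by
  have hf : ∀ y, ∑' x : {x // ρ x = y}, p x.1 * v (ρ x.1) = v y := by
    intro y
    have := hρ y
    rw [tsum_eq_finsum (Set.toFinite _)]
    rw [finsum_congr (g := fun x : {x // ρ x = y} => p x.1 * v y) fun x => by rw [x.2],
      ← finsum_mul, h1, one_mul]
  have hsum : Summable ((fun x => p x * v (ρ x)) ∘ Equiv.sigmaFiberEquiv ρ) := by
    refine (summable_sigma_of_nonneg fun x => mul_nonneg (hp _) (hv _)).2 ⟨fun y => ?_, ?_⟩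
    · have := hρ y
      exact summable_of_hasFiniteSupport (Set.toFinite _)
    · exact hs.summable.congr fun y => (hf y).symm
  have := hsum.hasSum
  rw [hsum.tsum_sigma.trans ((tsum_congr hf).trans hs.tsum_eq)] at this
  exact (Equiv.sigmaFiberEquiv ρ).hasSum_iff.1 this

/-- The isometry `f ↦ √p · (f ∘ ρ)` of `ℓ²`. -/
def weightedComposition (hρ : ∀ y, Finite {x // ρ x = y}) (hp : ∀ x, 0 ≤ p x)
    (h1 : ∀ y, ∑ᶠ x : {x // ρ x = y}, p x.1 = 1) :
    SquareSummable J →L[ℂ] SquareSummable J :=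
  have h : ∀ f : SquareSummable J,
      HasSum (fun x => ‖((√(p x) : ℝ) : ℂ) * f (ρ x)‖ ^ 2) (‖f‖ ^ 2) := fun f => by
    refine (hasSum_weight_mul_comp hρ hp h1 (fun x => by positivity) f.hasSum_norm_sq).congr_fun ?_
    intro x
    rw [norm_mul, mul_pow, Complex.norm_real, Real.norm_of_nonneg (Real.sqrt_nonneg _),
      Real.sq_sqrt (hp x)]
  LinearMap.mkContinuous
    { toFun := fun f => ⟨fun x => ((√(p x) : ℝ) : ℂ) * f (ρ x),
        memℓp_two_of_summable (h f).summable⟩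
      map_add' := fun f g => lp.ext (funext fun x => mul_add _ _ _)
      map_smul' := fun c f => lp.ext (funext fun x => mul_left_comm _ _ _) }
    1 fun f => by
      rw [one_mul]
      refine le_of_eq ((pow_left_inj₀ (norm_nonneg _) (norm_nonneg _) two_ne_zero).1 ?_)
      exact (SquareSummable.hasSum_norm_sq _).unique (h f)

theorem weightedComposition_apply (hρ : ∀ y, Finite {x // ρ x = y}) (hp : ∀ x, 0 ≤ p x)
    (h1 : ∀ y, ∑ᶠ x : {x // ρ x = y}, p x.1 = 1) (f : SquareSummable J) (x : J) :
    weightedComposition hρ hp h1 f x = ((√(p x) : ℝ) : ℂ) * f (ρ x) := rfl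

/-- The two square roots combine, so ⟨g, V^* a V f⟩ is the sum over x of p(x) a(x) f(ρ x) times the
conjugate of g(ρ x). Grouping by fibres replaces p a by b. -/
theorem star_weightedComposition_mul [TopologicalSpace J] [CompactSpace J]
    (hρ : ∀ y, Finite {x // ρ x = y}) (hp : ∀ x, 0 ≤ p x)
    (h1 : ∀ y, ∑ᶠ x : {x // ρ x = y}, p x.1 = 1) {a b : C(J, ℂ)}
    (hab : ∀ y, b y = ∑ᶠ x : {x // ρ x = y}, (p x.1 : ℂ) * a x.1) :
    star (weightedComposition hρ hp h1) * multiplicationRep J a * weightedComposition hρ hp h1 =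
      multiplicationRep J b := by
  refine ContinuousLinearMap.ext fun f => ext_inner_left ℂ fun g => ?_
  change ⟪g, star (weightedComposition hρ hp h1)
    (multiplicationRep J a (weightedComposition hρ hp h1 f))⟫_ℂ = _
  rw [ContinuousLinearMap.star_eq_adjoint, ContinuousLinearMap.adjoint_inner_right,
    lp.inner_eq_tsum, lp.inner_eq_tsum, tsum_eq_tsum_finsum_fibre hρ (lp.summable_inner _ _)]
  refine tsum_congr fun y => ?_
  have := hρ y
  have e : ⟪g y, multiplicationRep J b f y⟫_ℂ = ∑ᶠ x : {x // ρ x = y},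
      ((p x.1 : ℂ) * a x.1) * (f y * (starRingEnd ℂ) (g y)) := by
    rw [multiplicationRep_apply, hab, RCLike.inner_apply, mul_assoc, finsum_mul]
  refine Eq.trans (finsum_congr fun x => ?_) e.symm
  rw [multiplicationRep_apply, weightedComposition_apply, weightedComposition_apply, x.2,
    RCLike.inner_apply, map_mul]
  have h2 : ((p x.1 : ℝ) : ℂ) = ((√(p x.1) : ℝ) : ℂ) * ((√(p x.1) : ℝ) : ℂ) := by
    rw [← Complex.ofReal_mul, Real.mul_self_sqrt (hp _)]
  rw [h2]
  simp only [Complex.conj_ofReal]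
  ring

end SquareSummable

/-! ### Faithfulness of the coefficient algebra in the Toeplitz algebra. -/

section Toeplitz

/-- The whole fibre over a point of the Julia set lies in the Julia set (used in `juliaSum_eq`), so
no part of the total multiplicity deg R is lost by restricting. -/
theorem sum_branchIndex_julia {R : RatFunc ℂ} (hR : 0 < degree R) (y : Julia R) :
    ∑ᶠ x : {x : Julia R // juliaMap R x = y}, ((branchIndex R x.1 : ℝ) / degree R) = 1 := by
  have h1 := juliaSum_eq hR y fun _ => 1
  simp only [mul_one] at h1
  have h2 := sum_branchIndex hR (y : Sphere)
  have hd : (degree R : ℝ) ≠ 0 := by exact_mod_cast hR.ne'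
  have := finite_juliaFibre hR y
  have := Fintype.ofFinite {x : Julia R // juliaMap R x = y}
  rw [finsum_eq_sum_of_fintype] at h1 ⊢
  rw [← Finset.sum_div, div_eq_one_iff_eq hd]
  rw [← h2]
  exact_mod_cast h1

theorem transfer_apply {R : RatFunc ℂ} (hR : 0 < degree R) (a : C(Julia R, ℂ)) (y : Julia R) :
    transfer hR a y = (1 / degree R : ℂ) *
      ∑ᶠ x : {x : Julia R // juliaMap R x = y}, (branchIndex R x.1 : ℂ) * a x.1 := rfl

/-- The coefficient algebra has a faithful representation that extends to the Toeplitz algebra. -/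
theorem exists_faithful_toeplitz {R : RatFunc ℂ} (hR : 0 < degree R) :
    ∃ ψ : ExelToeplitz (transferSystem hR) →⋆ₐ[ℂ]
        (SquareSummable (Julia R) →L[ℂ] SquareSummable (Julia R)),
      ∀ a, ψ (ExelToeplitz.ofA _ a) = multiplicationRep (Julia R) a := by
  have hp : ∀ x : Julia R, 0 ≤ (branchIndex R x : ℝ) / degree R := fun x => by positivity
  -- With the weights e(x) / deg R, compressing multiplication by a with V gives multiplication by
  -- E_R(a).
  let V := weightedComposition (p := fun x : Julia R => (branchIndex R x : ℝ) / degree R)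
    (finite_juliaFibre hR) hp (sum_branchIndex_julia hR)
  have hold : (toeplitzRelations (transferSystem hR)).Holds _
      (Sum.elim (multiplicationRep (Julia R)) fun _ => V) := by
    refine ⟨multiplicationRep (Julia R), V, fun a => ?_, fun a => ?_, rfl⟩
    · refine ContinuousLinearMap.ext fun f => lp.ext (funext fun x => ?_)
      exact mul_left_comm _ _ _
    · refine star_weightedComposition_mul _ _ _ fun y => ?_
      change transfer hR a y = _
      have := finite_juliaFibre hR y
      rw [transfer_apply, mul_finsum]
      refine finsum_congr fun x => ?_
      push_cast
      ring
  obtain ⟨ψ, hψ, -⟩ := (toeplitzRelations (transferSystem hR)).existsUnique_lift hold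
  exact ⟨ψ, fun a => hψ (Sum.inl a)⟩

end Toeplitz

/-! ### Canonical generators of universal C⋆-algebras. -/

section Universal

universe u

/-- The universal algebra sits inside a product of representations, and its coordinate projections
are homomorphisms of the required kind. Defining relations for the canonical generators can thus be
read off in each representation. -/
theorem Relations.universal_ext {G : Type u} (P : Relations G) {x y : P.Universal}
    (h : ∀ (B : Type u) [CStarAlgebra B] (g : G → B), P.Holds B g →
      ∀ ψ : P.Universal →⋆ₐ[ℂ] B, (∀ z, ψ (P.gen z) = g z) → ψ x = ψ y) : x = y := by
  refine Subtype.ext (lp.ext (funext fun N => ?_))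
  let ev : lp (fun N : P.Index => (P.rep N).B) ⊤ →⋆ₐ[ℂ] (P.rep N).B :=
    { toFun := fun b => b N
      map_one' := rfl
      map_mul' := fun _ _ => rfl
      map_zero' := rfl
      map_add' := fun _ _ => rfl
      commutes' := fun _ => rfl
      map_star' := fun _ => rfl }
  exact h _ _ (P.rep N).holds (ev.comp P.universal.subtype) fun z => rfl

theorem continuous_starAlgHom {B C : Type*} [CStarAlgebra B] [CStarAlgebra C] (ψ : B →⋆ₐ[ℂ] C) :
    Continuous ψ :=
  AddMonoidHomClass.continuous_of_bound ψ 1 fun u => by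
    rw [one_mul]; exact NonUnitalStarAlgHom.norm_apply_le ψ u

theorem Relations.hom_ext {G : Type u} (P : Relations G) {B : Type u} [CStarAlgebra B]
    {ψ φ : P.Universal →⋆ₐ[ℂ] B} (h : ∀ x, ψ (P.gen x) = φ (P.gen x)) : ψ = φ := by
  refine StarAlgHom.ext_topologicalClosure (continuous_starAlgHom ψ) (continuous_starAlgHom φ) ?_
  refine StarAlgHom.ext_adjoin ?_
  rintro ⟨_, hx⟩ ⟨x, rfl⟩
  exact h x

namespace ExelToeplitz

variable {A : Type u} [CStarAlgebra A] (D : TransferSystem A)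

/-- The canonical homomorphism from `A` to the Toeplitz algebra. -/
def ofAHom : A →⋆ₐ[ℂ] ExelToeplitz D where
  toFun := ofA D
  map_one' := (toeplitzRelations D).universal_ext fun B _ g hg ψ hψ => by
    obtain ⟨i, V, -, -, rfl⟩ := hg
    rw [ofA, hψ, map_one]; exact map_one i
  map_mul' a b := (toeplitzRelations D).universal_ext fun B _ g hg ψ hψ => by
    obtain ⟨i, V, -, -, rfl⟩ := hg
    simp only [ofA, map_mul, hψ, Sum.elim_inl]
  map_zero' := (toeplitzRelations D).universal_ext fun B _ g hg ψ hψ => by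
    obtain ⟨i, V, -, -, rfl⟩ := hg
    simp only [ofA, map_zero, hψ, Sum.elim_inl]
  map_add' a b := (toeplitzRelations D).universal_ext fun B _ g hg ψ hψ => by
    obtain ⟨i, V, -, -, rfl⟩ := hg
    simp only [ofA, map_add, hψ, Sum.elim_inl]
  commutes' c := (toeplitzRelations D).universal_ext fun B _ g hg ψ hψ => by
    obtain ⟨i, V, -, -, rfl⟩ := hg
    rw [ofA, hψ, AlgHomClass.commutes]; exact AlgHomClass.commutes i c
  map_star' a := (toeplitzRelations D).universal_ext fun B _ g hg ψ hψ => by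
    obtain ⟨i, V, -, -, rfl⟩ := hg
    simp only [ofA, map_star, hψ, Sum.elim_inl]

theorem ofAHom_apply (a : A) : ofAHom D a = ofA D a := rfl

theorem S_mul_ofAHom (a : A) : S D * ofAHom D a = ofAHom D (D.α a) * S D :=
  (toeplitzRelations D).universal_ext fun B _ g hg ψ hψ => by
    obtain ⟨i, V, h, -, rfl⟩ := hg
    simpa only [ofAHom_apply, ofA, S, map_mul, hψ, Sum.elim_inl, Sum.elim_inr] using h a

theorem star_S_mul_ofAHom_mul_S (a : A) : star (S D) * ofAHom D a * S D = ofAHom D (D.L a) :=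
  (toeplitzRelations D).universal_ext fun B _ g hg ψ hψ => by
    obtain ⟨i, V, -, h, rfl⟩ := hg
    simpa only [ofAHom_apply, ofA, S, map_mul, map_star, hψ, Sum.elim_inl, Sum.elim_inr] using h a

theorem hom_ext {B : Type u} [CStarAlgebra B] {ψ φ : ExelToeplitz D →⋆ₐ[ℂ] B}
    (h : ∀ a, ψ (ofAHom D a) = φ (ofAHom D a)) (hS : ψ (S D) = φ (S D)) : ψ = φ :=
  (toeplitzRelations D).hom_ext fun x => by
    rcases x with a | ⟨⟩
    · exact h a
    · exact hS

theorem exists_lift {B : Type u} [CStarAlgebra B] (i : A →⋆ₐ[ℂ] B) (V : B)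
    (h : ∀ a, V * i a = i (D.α a) * V) (hL : ∀ a, star V * i a * V = i (D.L a)) :
    ∃ ψ : ExelToeplitz D →⋆ₐ[ℂ] B, (∀ a, ψ (ofAHom D a) = i a) ∧ ψ (S D) = V := by
  obtain ⟨ψ, hψ, -⟩ := (toeplitzRelations D).existsUnique_lift ⟨i, V, h, hL, rfl⟩
  exact ⟨ψ, fun a => hψ (Sum.inl a), hψ (Sum.inr PUnit.unit)⟩

end ExelToeplitz

section Compact

variable {A X : Type u} [CommCStarAlgebra A] [PartialOrder A] [StarOrderedRing A]
  [NormedAddCommGroup X] [NormedSpace ℂ X] [SMul A X] [CStarModule A X]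

/-- Rank one operators span a dense subspace. This uniqueness identifies the maps i_K of different
representations once a homomorphism intertwines them. -/
theorem compactOperators_hom_ext {B : Type u} [CStarAlgebra B]
    {f g : compactOperators A X →L[ℂ] B}
    (h : ∀ ξ η, f ⟨rankOne A ξ η, rankOne_mem A ξ η⟩ = g ⟨rankOne A ξ η, rankOne_mem A ξ η⟩) :
    f = g := by
  let K : Submodule ℂ (X →L[ℂ] X) := compactOperators A X
  refine ContinuousLinearMap.ext fun T => ?_
  have hspan : ∀ T (hT : T ∈ Submodule.span ℂ (Set.range fun p : X × X => rankOne A p.1 p.2)),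
      f ⟨T, Submodule.le_topologicalClosure _ hT⟩ =
        g ⟨T, Submodule.le_topologicalClosure _ hT⟩ := by
    intro T hT
    have : Submodule.span ℂ (Set.range fun p : X × X => rankOne A p.1 p.2) ≤
        (LinearMap.eqLocus f.toLinearMap g.toLinearMap).map K.subtype := by
      refine Submodule.span_le.2 ?_
      rintro _ ⟨p, rfl⟩
      exact ⟨⟨_, rankOne_mem A p.1 p.2⟩, h p.1 p.2, rfl⟩
    obtain ⟨z, hz, rfl⟩ := this hT
    exact hz
  have hd : Dense {T : K | T.1 ∈ Submodule.span ℂ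
      (Set.range fun p : X × X => rankOne A p.1 p.2)} := by
    rw [Subtype.dense_iff]
    intro T hT
    refine closure_mono ?_ hT
    exact fun T hT => ⟨⟨T, Submodule.le_topologicalClosure _ hT⟩, hT, rfl⟩
  exact congrFun (Continuous.ext_on hd f.continuous g.continuous fun T hT => hspan T.1 hT) T

end Compact

/-! ### The canonical covariant representation in the Cuntz–Pimsner algebra. -/

namespace CuntzPimsner

variable {A X : Type u} [CommCStarAlgebra A] [PartialOrder A] [StarOrderedRing A]
  [NormedAddCommGroup X] [NormedSpace ℂ X] [SMul A X] [CStarModule A X] [CompleteSpace X]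
  (Φ : LeftAction A X)

/-- The canonical homomorphism from `A` to `O_X`. -/
def hom : A →⋆ₐ[ℂ] CuntzPimsner Φ where
  toFun a := (cuntzPimsnerRelations Φ).gen (Sum.inl a)
  map_one' := (cuntzPimsnerRelations Φ).universal_ext fun B _ g hg ψ hψ => by
    obtain ⟨i, T, -, rfl⟩ := hg
    rw [hψ, map_one]; exact map_one i
  map_mul' a b := (cuntzPimsnerRelations Φ).universal_ext fun B _ g hg ψ hψ => by
    obtain ⟨i, T, -, rfl⟩ := hg
    simp only [map_mul, hψ, Sum.elim_inl]
  map_zero' := (cuntzPimsnerRelations Φ).universal_ext fun B _ g hg ψ hψ => by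
    obtain ⟨i, T, -, rfl⟩ := hg
    simp only [map_zero, hψ, Sum.elim_inl]
  map_add' a b := (cuntzPimsnerRelations Φ).universal_ext fun B _ g hg ψ hψ => by
    obtain ⟨i, T, -, rfl⟩ := hg
    simp only [map_add, hψ, Sum.elim_inl]
  commutes' c := (cuntzPimsnerRelations Φ).universal_ext fun B _ g hg ψ hψ => by
    obtain ⟨i, T, -, rfl⟩ := hg
    rw [hψ, AlgHomClass.commutes]; exact AlgHomClass.commutes i c
  map_star' a := (cuntzPimsnerRelations Φ).universal_ext fun B _ g hg ψ hψ => by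
    obtain ⟨i, T, -, rfl⟩ := hg
    simp only [map_star, hψ, Sum.elim_inl]

/-- The canonical map `ξ ↦ S_ξ` from `X` to `O_X`. -/
def S : X →ₗ[ℂ] CuntzPimsner Φ where
  toFun ξ := (cuntzPimsnerRelations Φ).gen (Sum.inr ξ)
  map_add' a b := (cuntzPimsnerRelations Φ).universal_ext fun B _ g hg ψ hψ => by
    obtain ⟨i, T, -, rfl⟩ := hg
    simp only [map_add, hψ, Sum.elim_inr]
  map_smul' c a := (cuntzPimsnerRelations Φ).universal_ext fun B _ g hg ψ hψ => by
    obtain ⟨i, T, -, rfl⟩ := hg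
    simp only [map_smul, hψ, Sum.elim_inr, RingHom.id_apply]

theorem hom_apply (a : A) : hom Φ a = (cuntzPimsnerRelations Φ).gen (Sum.inl a) := rfl

theorem S_apply (ξ : X) : S Φ ξ = (cuntzPimsnerRelations Φ).gen (Sum.inr ξ) := rfl

theorem isModuleRep : IsModuleRep (hom Φ) (S Φ) where
  right a ξ := (cuntzPimsnerRelations Φ).universal_ext fun B _ g hg ψ hψ => by
    obtain ⟨i, T, h, rfl⟩ := hg
    simpa only [hom_apply, S_apply, map_mul, hψ, Sum.elim_inl, Sum.elim_inr] using h.right a ξ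
  star_mul ξ η := (cuntzPimsnerRelations Φ).universal_ext fun B _ g hg ψ hψ => by
    obtain ⟨i, T, h, rfl⟩ := hg
    simpa only [hom_apply, S_apply, map_mul, map_star, hψ, Sum.elim_inl, Sum.elim_inr] using
      h.star_mul ξ η

/-- Covariance asks for a map i_K, so it cannot simply be tested coordinatewise. The map is first
built from the module relations alone; following it by a representation gives that representation's
own map, by uniqueness on rank one operators, and covariance is then inherited. -/
theorem isCovariant : IsCovariant Φ (hom Φ) (S Φ) where
  left a ξ := (cuntzPimsnerRelations Φ).universal_ext fun B _ g hg ψ hψ => by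
    obtain ⟨i, T, h, rfl⟩ := hg
    simpa only [hom_apply, S_apply, map_mul, hψ, Sum.elim_inl, Sum.elim_inr] using h.left a ξ
  right := (isModuleRep Φ).right
  star_mul := (isModuleRep Φ).star_mul
  covariant := by
    obtain ⟨iK, hK, -, -⟩ := (isModuleRep Φ).exists_compact
    refine ⟨iK, hK, fun a ha => ?_⟩
    refine (cuntzPimsnerRelations Φ).universal_ext fun B _ g hg ψ hψ => ?_
    obtain ⟨i, T, h, rfl⟩ := hg
    obtain ⟨jK, hjK, hj⟩ := h.covariant
    let ψL : CuntzPimsner Φ →L[ℂ] B := ⟨ψ.toAlgHom.toLinearMap, continuous_starAlgHom ψ⟩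
    have : ψL.comp iK = jK := compactOperators_hom_ext fun ξ η => by
      rw [hjK]
      change ψ (iK _) = _
      rw [hK, map_mul, map_star, S_apply, S_apply, hψ, hψ]
      rfl
    rw [hom_apply, hψ]
    change i a = ψL.comp iK _
    rw [this]
    exact hj a ha

theorem hom_ext {B : Type u} [CStarAlgebra B] {ψ φ : CuntzPimsner Φ →⋆ₐ[ℂ] B}
    (h : ∀ a, ψ (hom Φ a) = φ (hom Φ a)) (hS : ∀ ξ, ψ (S Φ ξ) = φ (S Φ ξ)) : ψ = φ :=
  (cuntzPimsnerRelations Φ).hom_ext fun x => by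
    rcases x with a | ξ
    · exact h a
    · exact hS ξ

theorem exists_lift {B : Type u} [CStarAlgebra B] {i : A →⋆ₐ[ℂ] B} {T : X →ₗ[ℂ] B}
    (h : IsCovariant Φ i T) :
    ∃ ψ : CuntzPimsner Φ →⋆ₐ[ℂ] B, (∀ a, ψ (hom Φ a) = i a) ∧ ∀ ξ, ψ (S Φ ξ) = T ξ := by
  obtain ⟨ψ, hψ, -⟩ := (cuntzPimsnerRelations Φ).existsUnique_lift ⟨i, T, h, rfl⟩
  exact ⟨ψ, fun a => hψ (Sum.inl a), fun ξ => hψ (Sum.inr ξ)⟩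

end CuntzPimsner

end Universal

/-! ### The graph bimodule in terms of α and the transfer operator. -/

section Isomorphism

open scoped ComplexOrder

variable {R : RatFunc ℂ} (hR : 0 < degree R)

namespace GraphModule

/-- The function `x ↦ f(x, R(x))` of an element `f` of the module. -/
def pullback : GraphModule hR →ₗ[ℂ] C(Julia R, ℂ) where
  toFun f := ⟨fun x => f (toGraph R x), (map_continuous f).comp (toGraph R).continuous⟩
  map_add' _ _ := rfl
  map_smul' _ _ := rfl

/-- The element `(x, y) ↦ a(x)` of the module. -/
def ofFun (a : C(Julia R, ℂ)) : GraphModule hR :=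
  mk hR ⟨fun p => a p.1.1, a.continuous.comp (continuous_fst.comp continuous_subtype_val)⟩

variable {hR}

theorem pullback_ofFun (a : C(Julia R, ℂ)) : pullback hR (ofFun hR a) = a := rfl

theorem toGraph_fst (p : Graph R) : toGraph R p.1.1 = p :=
  Subtype.ext (Prod.ext rfl p.2.symm)

/-- A point of the graph is determined by its first coordinate, so every element of X is φ(a)
applied to the constant function 1. -/
theorem ofFun_pullback (f : GraphModule hR) : ofFun hR (pullback hR f) = f :=
  ext fun p => congrArg f (toGraph_fst p)

theorem pullback_injective : Function.Injective (pullback hR) :=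
  Function.LeftInverse.injective ofFun_pullback

theorem pullback_φ (a : C(Julia R, ℂ)) (f : GraphModule hR) :
    pullback hR ((graphAction hR).φ a f) = a * pullback hR f := rfl

theorem pullback_op_smul (b : C(Julia R, ℂ)) (f : GraphModule hR) :
    pullback hR (b • f) = pullback hR f * (transferSystem hR).α b := rfl

/-- The inner product carries no normalisation whereas E_R divides by deg R; the discrepancy is the
source of every √(deg R) below. -/
theorem inner_eq_transfer (f g : GraphModule hR) :
    inner C(Julia R, ℂ) f g =
      (degree R : ℂ) • transfer hR (star (pullback hR f) * pullback hR g) := by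
  have hd : (degree R : ℂ) ≠ 0 := by exact_mod_cast hR.ne'
  refine ContinuousMap.ext fun y => ?_
  rw [ContinuousMap.smul_apply, transfer_apply, inner_apply, smul_eq_mul, ← mul_assoc,
    mul_one_div_cancel hd, one_mul]
  refine finsum_congr fun x => ?_
  obtain ⟨x, rfl⟩ := x
  rfl

end GraphModule

open GraphModule

section

variable {B : Type} [CStarAlgebra B] {i : C(Julia R, ℂ) →⋆ₐ[ℂ] B} {V : B}

/-- The square root of the degree, as a complex number. -/
def sqrtDegree (R : RatFunc ℂ) : ℂ := (√(degree R) : ℝ)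

theorem sqrtDegree_mul_self (R : RatFunc ℂ) : sqrtDegree R * sqrtDegree R = degree R := by
  rw [sqrtDegree, ← Complex.ofReal_mul, Real.mul_self_sqrt (Nat.cast_nonneg _),
    Complex.ofReal_natCast]

theorem star_sqrtDegree (R : RatFunc ℂ) : star (sqrtDegree R) = sqrtDegree R :=
  Complex.conj_ofReal _

theorem sqrtDegree_ne_zero {R : RatFunc ℂ} (hR : 0 < degree R) : sqrtDegree R ≠ 0 := by
  intro h
  have := sqrtDegree_mul_self R
  rw [h, zero_mul] at this
  exact hR.ne (by exact_mod_cast this)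

/-- The map `f ↦ √(deg R) a V`, where `a(x) = f(x, R(x))`. -/
def moduleMap (i : C(Julia R, ℂ) →⋆ₐ[ℂ] B) (V : B) : GraphModule hR →ₗ[ℂ] B :=
  sqrtDegree R • (LinearMap.mulRight ℂ V).comp (i.toAlgHom.toLinearMap.comp (pullback hR))

theorem moduleMap_apply (f : GraphModule hR) :
    moduleMap hR i V f = sqrtDegree R • (i (pullback hR f) * V) := rfl

/-- This places the images of rank one operators in A V V^* A, and conversely gives every element a
V V^* b up to the nonzero scalar deg R. -/
theorem moduleMap_mul_star (f g : GraphModule hR) :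
    moduleMap hR i V f * star (moduleMap hR i V g) =
      (degree R : ℂ) • (i (pullback hR f) * V * star V * i (star (pullback hR g))) := by
  rw [moduleMap_apply, moduleMap_apply, star_smul, smul_mul_smul_comm, star_sqrtDegree,
    sqrtDegree_mul_self, star_mul, map_star]
  simp only [mul_assoc]

/-- The commutation V a = α(a) V yields the right action, and V^* a V = E_R(a) yields the inner
product, the two factors √(deg R) supplying deg R. -/
theorem isModuleRep_moduleMap (hα : ∀ a, V * i a = i ((transferSystem hR).α a) * V)
    (hL : ∀ a, star V * i a * V = i (transfer hR a)) :
    IsModuleRep i (moduleMap hR i V) where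
  right b f := by
    rw [moduleMap_apply, moduleMap_apply, pullback_op_smul, map_mul, smul_mul_assoc, mul_assoc,
      mul_assoc, hα]
  star_mul f g := by
    rw [inner_eq_transfer, map_smul, ← hL, moduleMap_apply, moduleMap_apply, star_smul,
      smul_mul_smul_comm, star_sqrtDegree, sqrtDegree_mul_self, star_mul, map_mul, map_star]
    simp only [mul_assoc]

theorem moduleMap_left (a : C(Julia R, ℂ)) (f : GraphModule hR) :
    i a * moduleMap hR i V f = moduleMap hR i V ((graphAction hR).φ a f) := by
  rw [moduleMap_apply, moduleMap_apply, pullback_φ, map_mul, mul_smul_comm, mul_assoc]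

end

/-! ### Redundancies as compact operators, and the comparison of universal properties. -/

open ExelToeplitz

/-- The map from the module to the Toeplitz algebra. -/
abbrev toeplitzMap : GraphModule hR →ₗ[ℂ] ExelToeplitz (transferSystem hR) :=
  moduleMap hR (ofAHom (transferSystem hR)) (S (transferSystem hR))

theorem isModuleRep_toeplitz : IsModuleRep (ofAHom (transferSystem hR))
    (toeplitzMap hR) :=
  isModuleRep_moduleMap hR (S_mul_ofAHom _) (star_S_mul_ofAHom_mul_S _)

theorem ofAHom_injective : Function.Injective (ofAHom (transferSystem hR)) := by
  obtain ⟨ψ, hψ⟩ := exists_faithful_toeplitz hR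
  intro a b h
  refine multiplicationRep_injective ?_
  rw [← hψ, ← hψ]
  exact congrArg ψ h

/-- ‖S_f‖² = ‖i((f | f))‖, and the injective homomorphism i is isometric. -/
theorem norm_moduleMap_toeplitz (f : GraphModule hR) :
    ‖toeplitzMap hR f‖ = ‖f‖ := by
  refine (pow_left_inj₀ (norm_nonneg _) (norm_nonneg _) two_ne_zero).1 ?_
  rw [sq, ← CStarRing.norm_star_mul_self, (isModuleRep_toeplitz hR).star_mul,
    CStarModule.norm_sq_eq C(Julia R, ℂ)]
  exact NonUnitalStarAlgHom.norm_map _ (ofAHom_injective hR) _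

/-- Every S_f is √(deg R) b S for some b in A, and every b occurs. The equation for a redundancy
thus says that k acts on the image of X as φ(a). -/
theorem toeplitz_mul_moduleMap_iff {k : ExelToeplitz (transferSystem hR)} {a : C(Julia R, ℂ)} :
    (∀ b, ofA (transferSystem hR) a * ofA (transferSystem hR) b * S (transferSystem hR) =
      k * ofA (transferSystem hR) b * S (transferSystem hR)) ↔
    ∀ f, k * toeplitzMap hR f =
      toeplitzMap hR
        ((graphAction hR).φ a f) := by
  constructor
  · intro h f
    rw [← moduleMap_left, moduleMap_apply, mul_smul_comm, mul_smul_comm, ← mul_assoc, ← mul_assoc]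
    exact congrArg _ (h (pullback hR f)).symm
  · intro h b
    have := h (ofFun hR b)
    rw [← moduleMap_left, moduleMap_apply, mul_smul_comm, mul_smul_comm, pullback_ofFun,
      ← mul_assoc, ← mul_assoc] at this
    exact ((smul_right_injective _ (sqrtDegree_ne_zero hR)) this).symm

/-- A homomorphism of the Toeplitz algebra that respects redundancies induces a covariant
representation of the bimodule. -/
theorem isCovariant_of_redundancy {B : Type} [CStarAlgebra B]
    (ψ : ExelToeplitz (transferSystem hR) →⋆ₐ[ℂ] B)
    (h : ∀ a k, IsRedundancy (transferSystem hR) a k → ψ (ofAHom _ a) = ψ k) :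
    IsCovariant (graphAction hR) (ψ.comp (ofAHom (transferSystem hR)))
      (moduleMap hR (ψ.comp (ofAHom (transferSystem hR))) (ψ (S (transferSystem hR)))) := by
  have hmod : IsModuleRep (ψ.comp (ofAHom (transferSystem hR)))
      (moduleMap hR (ψ.comp (ofAHom (transferSystem hR))) (ψ (S (transferSystem hR)))) := by
    refine isModuleRep_moduleMap hR (fun a => ?_) (fun a => ?_)
    · have := congrArg ψ (S_mul_ofAHom (transferSystem hR) a)
      rwa [map_mul, map_mul] at this
    · have := congrArg ψ (star_S_mul_ofAHom_mul_S (transferSystem hR) a)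
      rwa [map_mul, map_mul, map_star] at this
  refine ⟨moduleMap_left hR, hmod.right, hmod.star_mul, ?_⟩
  -- The map on compact operators is taken in the Toeplitz algebra and pushed forward by ψ. For
  -- compact φ(a), the pair of a and its image i_K(φ(a)) is a redundancy, so the hypothesis on ψ is
  -- exactly covariance.
  obtain ⟨iK, hK, hKS, hKc⟩ := (isModuleRep_toeplitz hR).exists_compact
  let ψL : ExelToeplitz (transferSystem hR) →L[ℂ] B :=
    ⟨ψ.toAlgHom.toLinearMap, continuous_starAlgHom ψ⟩
  refine ⟨ψL.comp iK, fun ξ η => ?_, fun a ha => h a _ ⟨?_, ?_⟩⟩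
  · change ψ (iK _) = _
    rw [hK, map_mul, map_star]
    simp only [moduleMap_apply, map_smul, map_mul]
    rfl
  · refine closure_mono ?_ (hKc ⟨_, ha⟩)
    refine Submodule.span_le.2 ?_
    rintro _ ⟨p, rfl⟩
    simp only [moduleMap_mul_star]
    refine Submodule.smul_mem _ _ (Submodule.subset_span ?_)
    exact ⟨(pullback hR p.1, star (pullback hR p.2)), rfl⟩
  · exact (toeplitz_mul_moduleMap_iff hR).2 fun f => hKS ⟨_, ha⟩ f

/-- Since α is unital, a = a α(1) 1, so Exel's condition on a holds for every a. -/
theorem mk_ofAHom_eq {a : C(Julia R, ℂ)} {k : ExelToeplitz (transferSystem hR)}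
    (h : IsRedundancy (transferSystem hR) a k) :
    ExelCrossedProduct.mk (transferSystem hR) (ofAHom _ a) = ExelCrossedProduct.mk _ k := by
  refine (ExelCrossedProduct.mk_eq_mk_iff _).2 (sub_mem_redundancyIdeal _ h ?_)
  refine subset_closure (Submodule.subset_span ⟨(a, 1, 1), ?_⟩)
  change a * (transferSystem hR).α 1 * 1 = a
  rw [show (transferSystem hR).α 1 = 1 from rfl, mul_one, mul_one]

/-- Every redundancy comes from a compact operator. -/
theorem redundancy_eq {B : Type} [CStarAlgebra B] {i : C(Julia R, ℂ) →⋆ₐ[ℂ] B}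
    {T : GraphModule hR →ₗ[ℂ] B} (hT : IsCovariant (graphAction hR) i T)
    {ψ : ExelToeplitz (transferSystem hR) →⋆ₐ[ℂ] B}
    (hψ : ∀ f, ψ (toeplitzMap hR f) = T f)
    {a : C(Julia R, ℂ)} {k : ExelToeplitz (transferSystem hR)}
    (h : IsRedundancy (transferSystem hR) a k) : ψ k = i a := by
  obtain ⟨iK, hK, hKS, -⟩ := (isModuleRep_toeplitz hR).exists_compact
  obtain ⟨jK, hjK, hj⟩ := hT.covariant
  have hWinj : ∀ f g, toeplitzMap hR f = toeplitzMap hR g → f = g := by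
    intro f g hfg
    rw [← sub_eq_zero, ← norm_eq_zero, ← norm_moduleMap_toeplitz hR, map_sub]
    rw [norm_eq_zero, sub_eq_zero]
    exact hfg
  -- ‖K f‖ = ‖S_{K f}‖ = ‖i_K(K) S_f‖ ≤ ‖i_K(K)‖ ‖f‖, because f ↦ S_f is isometric.
  have hbound : ∀ K : compactOperators C(Julia R, ℂ) (GraphModule hR), ‖K‖ ≤ ‖iK K‖ := by
    intro K
    refine K.1.opNorm_le_bound (norm_nonneg _) fun f => ?_
    rw [← norm_moduleMap_toeplitz hR (K.1 f), ← norm_moduleMap_toeplitz hR f]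
    rw [← hKS]
    exact norm_mul_le _ _
  have : CompleteSpace (compactOperators C(Julia R, ℂ) (GraphModule hR)) :=
    (Submodule.isClosed_topologicalClosure _).completeSpace_coe
  have hclosed : IsClosed (Set.range iK) := by
    have : AntilipschitzWith 1 iK :=
      AddMonoidHomClass.antilipschitz_of_bound iK fun K => by
        rw [NNReal.coe_one, one_mul]; exact hbound K
    exact this.isClosed_range iK.uniformContinuous
  -- The range contains each generator a S S^* b and is closed, hence contains their closed span.
  -- The adjoint on the second function undoes the one in S_f S_g^*.
  obtain ⟨K, rfl⟩ : k ∈ Set.range iK := by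
    refine closure_minimal ?_ hclosed h.1
    change ((Submodule.span ℂ _ : Submodule ℂ (ExelToeplitz (transferSystem hR))) : Set (ExelToeplitz (transferSystem hR))) ⊆
      (LinearMap.range iK.toLinearMap : Set (ExelToeplitz (transferSystem hR)))
    refine Submodule.span_le.2 ?_
    rintro _ ⟨p, rfl⟩
    have hd : (degree R : ℂ) ≠ 0 := by exact_mod_cast hR.ne'
    refine ⟨(degree R : ℂ)⁻¹ • ⟨_, rankOne_mem _ (ofFun hR p.1) (ofFun hR (star p.2))⟩, ?_⟩
    change iK _ = _
    rw [map_smul, hK, moduleMap_mul_star, smul_smul, inv_mul_cancel₀ hd, one_smul,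
      pullback_ofFun, pullback_ofFun, star_star]
    rfl
  -- Both operators have the same image S_{K f} = k S_f = S_{φ(a) f}, and f ↦ S_f is injective; in
  -- particular φ(a) is compact, so covariance applies to a.
  have hKa : K.1 = (graphAction hR).φ a := by
    refine ContinuousLinearMap.ext fun f => hWinj _ _ ?_
    rw [← hKS]
    exact (toeplitz_mul_moduleMap_iff hR).1 h.2 f
  let ψL : ExelToeplitz (transferSystem hR) →L[ℂ] B := ⟨ψ.toAlgHom.toLinearMap, continuous_starAlgHom ψ⟩
  have hψK : ψL.comp iK = jK := compactOperators_hom_ext fun ξ η => by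
    change ψ (iK _) = _
    rw [hK, hjK, map_mul, map_star, hψ, hψ]
  have hmem : (graphAction hR).φ a ∈ compactOperators C(Julia R, ℂ) (GraphModule hR) :=
    hKa ▸ K.2
  rw [hj a hmem, ← hψK]
  change ψ (iK K) = ψ (iK _)
  congr 2
  exact Subtype.ext hKa

/-- The homomorphism of the Toeplitz algebra induced by a representation of the bimodule. -/
theorem exists_toeplitz_hom {B : Type} [CStarAlgebra B] {i : C(Julia R, ℂ) →⋆ₐ[ℂ] B}
    {T : GraphModule hR →ₗ[ℂ] B} (hT : IsCovariant (graphAction hR) i T) :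
    ∃ ψ : ExelToeplitz (transferSystem hR) →⋆ₐ[ℂ] B,
      (∀ a, ψ (ofAHom (transferSystem hR) a) = i a) ∧ ∀ f, ψ (toeplitzMap hR f) = T f := by
  -- The cyclic vector 1. Its right multiple by a equals its left multiple by α(a), which gives the
  -- commutation relation for T(ξ); the inner product with left multiples gives the transfer
  -- relation.
  let ξ : GraphModule hR := ofFun hR 1
  have hleft : ∀ a, (graphAction hR).φ a ξ = ofFun hR a := fun a =>
    pullback_injective ((pullback_φ a ξ).trans (mul_one a))
  have h0 := sqrtDegree_ne_zero hR
  obtain ⟨ψ, h1, h2⟩ := ExelToeplitz.exists_lift (transferSystem hR) i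
    ((sqrtDegree R)⁻¹ • T ξ) (fun a => by
      rw [smul_mul_assoc, hT.right, mul_smul_comm, hT.left, hleft]
      congr 2
      exact pullback_injective ((pullback_op_smul a ξ).trans (one_mul _))) (fun a => by
      have hd : (degree R : ℂ) ≠ 0 := by exact_mod_cast hR.ne'
      rw [mul_assoc, mul_smul_comm, hT.left, hleft, star_smul, smul_mul_smul_comm, star_inv₀,
        star_sqrtDegree, hT.star_mul, inner_eq_transfer, map_smul, smul_smul, ← mul_inv,
        sqrtDegree_mul_self, inv_mul_cancel₀ hd, one_smul, pullback_ofFun, pullback_ofFun,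
        star_one, one_mul]
      rfl)
  refine ⟨ψ, h1, fun f => ?_⟩
  rw [moduleMap_apply, map_smul, map_mul, h1, h2, mul_smul_comm, smul_smul, mul_inv_cancel₀ h0,
    one_smul, hT.left, hleft, ofFun_pullback]

/-- The kernel of ψ is itself one of the closed self-adjoint ideals whose intersection is the
redundancy ideal. -/
theorem redundancyIdeal_le_ker {B : Type} [CStarAlgebra B]
    (ψ : ExelToeplitz (transferSystem hR) →⋆ₐ[ℂ] B)
    (h : ∀ a k, IsRedundancy (transferSystem hR) a k → ψ (ofAHom _ a) = ψ k)
    {x : ExelToeplitz (transferSystem hR)} (hx : x ∈ redundancyIdeal (transferSystem hR)) :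
    ψ x = 0 := by
  rw [redundancyIdeal, TwoSidedIdeal.mem_sInf] at hx
  have := hx (TwoSidedIdeal.ker ψ) ⟨?_, ?_, ?_⟩
  · exact (TwoSidedIdeal.mem_ker _).1 this
  · have : (TwoSidedIdeal.ker ψ : Set (ExelToeplitz (transferSystem hR))) = ψ ⁻¹' {0} :=
      Set.ext fun x => TwoSidedIdeal.mem_ker _
    rw [this]
    exact isClosed_singleton.preimage (continuous_starAlgHom ψ)
  · intro x hx
    rw [TwoSidedIdeal.mem_ker] at hx ⊢
    rw [map_star, hx, star_zero]
  · intro a k hak _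
    rw [TwoSidedIdeal.mem_ker, map_sub, sub_eq_zero]
    exact h a k hak

/-- Factorization of a homomorphism through Exel's crossed product. -/
theorem exists_lift_exel {B : Type} [CStarAlgebra B]
    (ψ : ExelToeplitz (transferSystem hR) →⋆ₐ[ℂ] B)
    (h : ∀ a k, IsRedundancy (transferSystem hR) a k → ψ (ofAHom _ a) = ψ k) :
    ∃ χ : ExelCrossedProduct (transferSystem hR) →⋆ₐ[ℂ] B,
      ∀ x, χ (ExelCrossedProduct.mk _ x) = ψ x := by
  let π := ExelCrossedProduct.mk (transferSystem hR)
  have hπ := ExelCrossedProduct.mk_surjective (transferSystem hR)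
  -- A mere set-theoretic section; ψ ∘ s does not depend on the choice because ψ kills the
  -- redundancy ideal.
  choose s hs using hπ
  have key : ∀ x, ψ (s (π x)) = ψ x := fun x => by
    rw [← sub_eq_zero, ← map_sub]
    exact redundancyIdeal_le_ker hR ψ h ((ExelCrossedProduct.mk_eq_mk_iff _).1 (hs (π x)))
  refine ⟨{ toFun := fun x => ψ (s x)
            map_one' := ?_
            map_mul' := fun x y => ?_
            map_zero' := ?_
            map_add' := fun x y => ?_
            commutes' := fun c => ?_
            map_star' := fun x => ?_ }, key⟩
  · rw [← map_one π, key, map_one]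
  · conv_lhs => rw [← hs x, ← hs y, ← map_mul]
    exact (key _).trans (map_mul _ _ _)
  · rw [← map_zero π, key, map_zero]
  · conv_lhs => rw [← hs x, ← hs y, ← map_add]
    exact (key _).trans (map_add _ _ _)
  · rw [← AlgHomClass.commutes π, key, AlgHomClass.commutes]
  · conv_lhs => rw [← hs x, ← map_star]
    exact (key _).trans (map_star _ _)

/-- A universal C⋆-algebra for covariant representations of the bimodule is isomorphic to any
universal quotient of the Toeplitz algebra in which redundancies become equalities. -/
theorem nonempty_equiv_of_universal {O E : Type} [CStarAlgebra O] [CStarAlgebra E]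
    {i : C(Julia R, ℂ) →⋆ₐ[ℂ] O} {T : GraphModule hR →ₗ[ℂ] O}
    (hcov : IsCovariant (graphAction hR) i T)
    (hext : ∀ ψ φ : O →⋆ₐ[ℂ] O, (∀ a, ψ (i a) = φ (i a)) → (∀ f, ψ (T f) = φ (T f)) → ψ = φ)
    (hO : ∀ (j : C(Julia R, ℂ) →⋆ₐ[ℂ] E) (U : GraphModule hR →ₗ[ℂ] E),
      IsCovariant (graphAction hR) j U →
      ∃ φ : O →⋆ₐ[ℂ] E, (∀ a, φ (i a) = j a) ∧ ∀ f, φ (T f) = U f)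
    (π : ExelToeplitz (transferSystem hR) →⋆ₐ[ℂ] E) (hsurj : Function.Surjective π)
    (hπ : ∀ a k, IsRedundancy (transferSystem hR) a k → π (ofAHom _ a) = π k)
    (hlift : ∀ ψ : ExelToeplitz (transferSystem hR) →⋆ₐ[ℂ] O,
      (∀ a k, IsRedundancy (transferSystem hR) a k → ψ (ofAHom _ a) = ψ k) →
      ∃ χ : E →⋆ₐ[ℂ] O, ∀ x, χ (π x) = ψ x) :
    Nonempty (O ≃⋆ₐ[ℂ] E) := by
  obtain ⟨ψ, hψ, hψS⟩ := exists_toeplitz_hom hR hcov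
  -- Descent to E needs ψ to respect redundancies, which is `redundancy_eq`. The opposite map φ
  -- exists because π makes the bimodule representation in E covariant.
  obtain ⟨χ, hχ⟩ := hlift ψ fun a k h => by rw [hψ, redundancy_eq hR hcov hψS h]
  obtain ⟨φ, hφ, hφS⟩ := hO _ _ (isCovariant_of_redundancy hR π hπ)
  have hmk : ∀ f, π (toeplitzMap hR f) = φ (T f) := fun f => by
    rw [hφS, moduleMap_apply, moduleMap_apply, map_smul, map_mul]
    rfl
  have h1 : χ.comp φ = StarAlgHom.id ℂ O := by
    refine hext _ _ (fun a => ?_) (fun f => ?_)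
    · change χ (φ _) = _
      rw [hφ]
      exact (hχ _).trans (hψ a)
    · change χ (φ _) = _
      rw [← hmk, hχ, hψS]
      rfl
  have h2 : φ.comp ψ = π := by
    refine ExelToeplitz.hom_ext _ (fun a => ?_) ?_
    · change φ (ψ _) = _
      rw [hψ, hφ]
      rfl
    -- At the constant function 1 the bimodule map gives √(deg R) S; cancelling the nonzero scalar
    -- shows agreement on S.
    · have h3 := (hmk (ofFun hR 1)).symm
      rw [← hψS, moduleMap_apply, map_smul, map_smul, map_smul, pullback_ofFun,
        map_one, one_mul] at h3
      exact smul_right_injective _ (sqrtDegree_ne_zero hR) h3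
  refine ⟨StarAlgEquiv.ofStarAlgHom φ χ ?_ ?_⟩
  · exact h1
  -- Elements of E are images of Toeplitz elements t, and φ(χ(π t)) = φ(ψ t) = π t.
  · refine StarAlgHom.ext fun x => ?_
    obtain ⟨t, rfl⟩ := hsurj x
    change φ (χ _) = _
    rw [hχ]
    exact congrArg (fun f => f t) h2

/-- `O_R` is isomorphic to Exel's crossed product. -/
theorem nonempty_rationalAlgebra_equiv :
    Nonempty (RationalAlgebra hR ≃⋆ₐ[ℂ] ExelCrossedProduct (transferSystem hR)) :=
  nonempty_equiv_of_universal hR (CuntzPimsner.isCovariant (graphAction hR))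
    (fun _ _ h hS => CuntzPimsner.hom_ext _ h hS)
    (fun _ _ h => CuntzPimsner.exists_lift _ h)
    (ExelCrossedProduct.mk (transferSystem hR)) (ExelCrossedProduct.mk_surjective _)
    (fun _ _ h => mk_ofAHom_eq hR h) fun ψ h => exists_lift_exel hR ψ h

end Isomorphism

end

end JuliaAlgebra

theorem mainTheorem9 (R : RatFunc ℂ) (hR : 0 < JuliaAlgebra.degree R)
    (hJ : (JuliaAlgebra.juliaSet R).Nonempty) :
    Nonempty (JuliaAlgebra.RationalAlgebra hR ≃⋆ₐ[ℂ]
      JuliaAlgebra.ExelCrossedProduct (JuliaAlgebra.transferSystem hR)) := by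
  exact JuliaAlgebra.nonempty_rationalAlgebra_equiv hR
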